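/- **Setting.** Consider $x_{t+1}=A(\theta^\ast)x_t+B(\theta^\ast)u_t+w_t$ with $x_t\in\mathbb R^{n_x}$, $u_t\in\mathbb R^{n_u}$, $(A(\theta),B(\theta))=(A_0,B_0)+\sum_{i=1}^p(A_i,B_i)[\theta]_i$, constraints $Fx_t+Gu_t\le\mathbf 1$, disturbances $w_t\in\mathcal W=\{w:\Pi_w w\le\pi_w\}$ and an unknown constant parameter $\theta^\ast\in\Theta_0=\Theta(\mu_0)$, where $\Theta(\mu)=\{\theta: M_\Theta\theta\le\mu\}$. Vector and matrix inequalities are entrywise, $\|\cdot\|$ is the Euclidean norm and $\|a\|_P^2=a^\top Pa$. Assume: * $\mathcal W$ is compact and $\pi_w>0$; $\Theta_0$ is bounded; $\mathcal Z=\{(x,u):Fx+Gu\le\mathbf 1\}$ is compact with the origin in its interior; $Q,R\succ0$; $N\ge1$ and $N_u\ge1$. * $\mathcal X(\mathbf 1)$, where $\mathcal X(\alpha)=\{x:Tx\le\alpha\}$, is a polytope without redundant inequalities, and for some $\lambda\in[0,1)$, $T(A(\theta)+B(\theta)K)x\le\lambda\mathbf 1$ for all $x\in\mathcal X(\mathbf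 1)$, $\theta\in\Theta_0$. * The matrices $U_1,\dots,U_m$ satisfy $[T]_iU_j=[I]_i$ for $i\in\mathcal R_j$, with $|\mathcal R_j|=n_x$, and $\mathcal X(\alpha)=\mathrm{Co}\{U_1\alpha,\dots,U_m\alpha\}$ for every $\alpha$ such that each inequality $[T]_ix\le[\alpha]_i$ is attained with equality in $\mathcal X(\alpha)$. Put $D(x,u)=[A_1x+B_1u\ \cdots\ A_px+B_pu]$, $d(x,u)=A_0x+B_0u$, $[\bar w]_i=\max_{w\in\mathcal W}[Tw]_i$, $\Phi(\theta)=A(\theta)+B(\theta)K$, and let $P(\theta)$ be the solution of $P-\Phi(\theta)^\top P\,\Phi(\theta)=Q+K^\top RK$. **Problem $\mathcal P$** at state $x$, with parameter set $\Theta(\mu)$, nominal parameter $\bar\theta$ and reference sequences $\hat x_k,\hat u_k$: minimize $$\sum_{k=0}^{N-1}\bigl(\|\bar x_k\|_Q^2+\|\bar u_k\|_R^2\bigr)+\|\bar x_N\|^2_{P(\bar\theta)}-\gamma\beta$$ over $v_k,\alpha_k,\bar x_k,\bar u_k$, $\beta\in\mathbb R$, matrices $\Lambda_{k,j}$ and $M_k$,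 with $v_k=0$ and $\alpha_k=\alpha_N$ for $k\ge N$, subject to * $Tx\le\alpha_0$, and $(F+GK)U_j\alpha_k+Gv_k\le\mathbf 1$ for all $j$ and $0\le k\le N$; * for all $j$ and $0\le k\le N$, with $z=U_j\alpha_k$ and $u=Kz+v_k$: $\Lambda_{k,j}\ge0$, $\Lambda_{k,j}M_\Theta=TD(z,u)$ and $\Lambda_{k,j}\mu\le\alpha_{k+1}-Td(z,u)-\bar w$; * $\bar x_0=x$, $\bar x_{k+1}=\Phi(\bar\theta)\bar x_k+B(\bar\theta)v_k$, $\bar u_k=K\bar x_k+v_k$; * with $\hat D_k=D(\hat x_k,\hat u_k)$ and $\tilde D_{k,j}=D(U_j\alpha_k-\hat x_k,\,KU_j\alpha_k+v_k-\hat u_k)$: $\hat D_k^\top\hat D_k+\tilde D_{k,j}^\top\hat D_k+\hat D_k^\top\tilde D_{k,j}\succeq M_k$ for all $j$ and $0\le k\le N_u-1$, and $\sum_{k=0}^{N_u-1}M_k\succeq\beta I$. **Closed loop.** $\bar\theta_0\in\Theta_0$ and the reference sequences at time $0$ are given. At each time $t\ge0$, $\mathcal P$ is solved at $x_t$ with $\Theta_t=\Theta(\mu_t)$,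 $\bar\theta_t$ and the current references, and $u_t=Kx_t+v^\ast_{0|t}$ is applied, where $v^\ast_{0|t}$ is the first element of the optimal $\mathbf v$. At each $t\ge1$, $\Theta_t=\Theta(\mu_t)$ is the smallest set of the form $\Theta(\mu)$ (with $\mu_t$ the entrywise least such $\mu$) containing $\Theta_{t-1}\cap\bigcap_{j=\max\{1,\,t-N_u+1\}}^{t}\Delta_j$, where $\Delta_j=\{\theta: x_j-A(\theta)x_{j-1}-B(\theta)u_{j-1}\in\mathcal W\}$; the nominal parameter is the projection $\bar\theta_t=\arg\min_{\theta\in\Theta_t}\|\bar\theta_{t-1}-\theta\|$; and the references are $\hat x_0=x_t$, $\hat x_{k+1}=A(\bar\theta_t)\hat x_k+B(\bar\theta_t)\hat u_k$, $\hat u_k=K\hat x_k+v^\ast_{k+1|t-1}$ (with $v^\ast_{k|t-1}=0$ for $k\ge N$). Let $X_{\mathcal P}$ be the set of initial states $x_0$ at which $\mathcal P$ is feasible at time $0$. **Corollary.** Let $\gamma=0$ and $X_{\mathcal P}\neq\emptyset$. Then: 1. For all $x_0\in X_{\mathcal P}$, $\theta^\ast\in\Theta_0$ and all sequences in $\mathcal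 W$, the closed loop is well defined for all times: closed-loop trajectories exist, and along each of them $\mathcal P$ has an optimal solution at every time. 2. All these trajectories satisfy $Fx_t+Gu_t\le\mathbf 1$ for all $t\ge0$. 3. The closed loop is input-to-state stable with region of attraction $X_{\mathcal P}$: $0$ is an interior point of $X_{\mathcal P}$, and there are a $\mathcal{KL}$-function $\eta$ and $\mathcal K$-functions $\psi,\zeta$ such that for all $x_0\in X_{\mathcal P}$, all $\theta^\ast\in\Theta_0$, all disturbance sequences in $\mathcal W$ and all $t\ge0$ $$\|x_t\|\le\eta(\|x_0\|,t)+\psi\Bigl(\max_{0\le k\le t-1}\|w_k\|\Bigr)+\zeta\Bigl(\max_{0\le k\le t-1}\|\bar\theta_k-\theta^\ast\|\Bigr),$$ where a maximum over the empty set is $0$. -/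

import Mathlib

open Matrix Set

noncomputable section

/-- Euclidean norm of a vector with real entries. -/
def l2norm {n : ℕ} (a : Fin n → ℝ) : ℝ := ‖(WithLp.toLp 2 a : EuclideanSpace ℝ (Fin n))‖

/-- The weighted square `aᵀ P a`. -/
def wsq {n : ℕ} (P : Matrix (Fin n) (Fin n) ℝ) (a : Fin n → ℝ) : ℝ := a ⬝ᵥ (P *ᵥ a)

/-- Class `𝒦` functions on `[0, ∞)`. -/
def IsClassK (σ : ℝ → ℝ) : Prop :=
  ContinuousOn σ (Ici 0) ∧ StrictMonoOn σ (Ici 0) ∧ σ 0 = 0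

/-- Class `𝒦ℒ` functions on `[0, ∞) × [0, ∞)`. -/
def IsClassKL (φ : ℝ → ℝ → ℝ) : Prop :=
  ContinuousOn (fun z : ℝ × ℝ => φ z.1 z.2) (Ici 0 ×ˢ Ici 0) ∧
  (∀ t, 0 ≤ t → IsClassK (fun s => φ s t)) ∧
  (∀ s, 0 ≤ s → AntitoneOn (φ s) (Ici 0) ∧ Filter.Tendsto (φ s) Filter.atTop (nhds 0))

/-- The raw data of the adaptive robust MPC scheme. The state, input and parameter spaces are
`ℝ^nx`, `ℝ^nu`, `ℝ^p`; there are `nc` state/input constraints, `nw` disturbance constraints,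
`r` parameter set constraints, `na` tube facets and `m` tube vertices. -/
structure MPCData (nx nu p nc nw r na m : ℕ) where
  /-- system matrices: `A(θ) = A0 + ∑ θ_l A_l`, `B(θ) = B0 + ∑ θ_l B_l` -/
  A0 : Matrix (Fin nx) (Fin nx) ℝ
  B0 : Matrix (Fin nx) (Fin nu) ℝ
  A : Fin p → Matrix (Fin nx) (Fin nx) ℝ
  B : Fin p → Matrix (Fin nx) (Fin nu) ℝ
  /-- state and input constraints `F x + G u ≤ 1` -/
  F : Matrix (Fin nc) (Fin nx) ℝ
  G : Matrix (Fin nc) (Fin nu) ℝ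
  /-- disturbance set `{w | Pw w ≤ pw}` -/
  Pw : Matrix (Fin nw) (Fin nx) ℝ
  pw : Fin nw → ℝ
  /-- parameter sets `Θ(μ) = {θ | Mth θ ≤ μ}`, with initial right-hand side `mu0` -/
  Mth : Matrix (Fin r) (Fin p) ℝ
  mu0 : Fin r → ℝ
  /-- tube cross sections `{x | T x ≤ α}`, feedback gain `K` -/
  T : Matrix (Fin na) (Fin nx) ℝ
  K : Matrix (Fin nu) (Fin nx) ℝ
  /-- vertex maps: the `j`-th vertex of `{x | T x ≤ α}` is `U j α`, at which the inequalities
  with index in `Ract j` are active -/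
  U : Fin m → Matrix (Fin nx) (Fin na) ℝ
  Ract : Fin m → Finset (Fin na)
  /-- stage cost weights -/
  Q : Matrix (Fin nx) (Fin nx) ℝ
  R : Matrix (Fin nu) (Fin nu) ℝ
  /-- prediction horizon -/
  N : ℕ
  /-- window length for parameter set updates and persistent excitation -/
  Nu : ℕ
  /-- weight of the persistent excitation term in the objective -/
  gam : ℝ
  /-- initial nominal parameter -/
  thbar0 : Fin p → ℝ
  /-- reference state and input sequences used at time `0`, possibly depending on the initial
  state -/
  refx0 : (Fin nx → ℝ) → ℕ → (Fin nx → ℝ)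
  refu0 : (Fin nx → ℝ) → ℕ → (Fin nu → ℝ)

/-- The decision variables of the MPC problem: input perturbations `v`, tube parameters `α`,
nominal predictions `xbar`, `ubar`, excitation level `beta` with auxiliary matrices `Mpe`, and
multipliers `Lam`. Sequences are indexed by all prediction steps; their tails beyond the horizon
are fixed by the constraints. -/
structure MPCDecision (nx nu p r na m : ℕ) where
  v : ℕ → (Fin nu → ℝ)
  α : ℕ → (Fin na → ℝ)
  xbar : ℕ → (Fin nx → ℝ)
  ubar : ℕ → (Fin nu → ℝ)
  beta : ℝ
  Mpe : ℕ → Matrix (Fin p) (Fin p) ℝ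
  Lam : ℕ → Fin m → Matrix (Fin na) (Fin r) ℝ

/-- All signals of the closed loop, indexed by time: plant state and input, parameter set
right-hand side `mu t`, nominal parameter `thbar t`, reference sequences `xhat t`, `uhat t` and
the decision variables `dec t` computed at time `t`. -/
structure MPCSignals (nx nu p r na m : ℕ) where
  x : ℕ → (Fin nx → ℝ)
  u : ℕ → (Fin nu → ℝ)
  mu : ℕ → (Fin r → ℝ)
  thbar : ℕ → (Fin p → ℝ)
  xhat : ℕ → ℕ → (Fin nx → ℝ)
  uhat : ℕ → ℕ → (Fin nu → ℝ)
  dec : ℕ → MPCDecision nx nu p r na m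

namespace MPCData

variable {nx nu p nc nw r na m : ℕ} (D : MPCData nx nu p nc nw r na m)

/-- `A(θ)` -/
def Ath (θ : Fin p → ℝ) : Matrix (Fin nx) (Fin nx) ℝ := D.A0 + ∑ l, θ l • D.A l

/-- `B(θ)` -/
def Bth (θ : Fin p → ℝ) : Matrix (Fin nx) (Fin nu) ℝ := D.B0 + ∑ l, θ l • D.B l

/-- `Φ(θ) = A(θ) + B(θ) K` -/
def Phi (θ : Fin p → ℝ) : Matrix (Fin nx) (Fin nx) ℝ := D.Ath θ + D.Bth θ * D.K

/-- The regressor `D(x,u) = [A_1 x + B_1 u, …, A_p x + B_p u]`. -/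
def regD (x : Fin nx → ℝ) (u : Fin nu → ℝ) : Matrix (Fin nx) (Fin p) ℝ :=
  Matrix.of fun i l => (D.A l *ᵥ x + D.B l *ᵥ u) i

/-- `d(x,u) = A_0 x + B_0 u` -/
def regd (x : Fin nx → ℝ) (u : Fin nu → ℝ) : Fin nx → ℝ := D.A0 *ᵥ x + D.B0 *ᵥ u

/-- The disturbance set `𝒲`. -/
def W : Set (Fin nx → ℝ) := {w | D.Pw *ᵥ w ≤ D.pw}

/-- The parameter set `Θ(μ)`. -/
def Theta (μ : Fin r → ℝ) : Set (Fin p → ℝ) := {θ | D.Mth *ᵥ θ ≤ μ}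

/-- The constraint set `𝒵`. -/
def Z : Set ((Fin nx → ℝ) × (Fin nu → ℝ)) := {z | D.F *ᵥ z.1 + D.G *ᵥ z.2 ≤ 1}

/-- The tube cross section `{x | T x ≤ α}`. -/
def X (α : Fin na → ℝ) : Set (Fin nx → ℝ) := {x | D.T *ᵥ x ≤ α}

/-- `w̄`, with entries `max_{w ∈ 𝒲} [T w]_i`. -/
def wbar : Fin na → ℝ := fun i => sSup ((fun w => (D.T *ᵥ w) i) '' D.W)

/-- Parameters unfalsified by one observed transition `(x, u) ↦ xplus`. -/
def Delta (xplus x : Fin nx → ℝ) (u : Fin nu → ℝ) : Set (Fin p → ℝ) :=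
  {θ | xplus - D.Ath θ *ᵥ x - D.Bth θ *ᵥ u ∈ D.W}

/-- `P(θ)`: the solution of `P - Φ(θ)ᵀ P Φ(θ) = Q + Kᵀ R K` (which is unique for `Φ(θ)` stable). -/
def lyapP (θ : Fin p → ℝ) : Matrix (Fin nx) (Fin nx) ℝ :=
  Classical.epsilon fun P => P - (D.Phi θ)ᵀ * P * D.Phi θ = D.Q + D.Kᵀ * D.R * D.K

/-- Standing assumptions of the scheme. -/
structure Assumptions : Prop where
  pw_pos : ∀ i, 0 < D.pw i
  W_compact : IsCompact D.W
  Theta0_bounded : Bornology.IsBounded (D.Theta D.mu0)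
  Z_compact : IsCompact D.Z
  Z_interior : (0 : (Fin nx → ℝ) × (Fin nu → ℝ)) ∈ interior D.Z
  /-- `{x | T x ≤ 1}` is a polytope, -/
  X_bounded : Bornology.IsBounded (D.X 1)
  /-- it is contractive with factor `lam < 1` for all admissible parameters, -/
  contractive : ∃ lam : ℝ, 0 ≤ lam ∧ lam < 1 ∧
    ∀ θ ∈ D.Theta D.mu0, ∀ x ∈ D.X 1, ∀ i, (D.T *ᵥ (D.Phi θ *ᵥ x)) i ≤ lam
  /-- and none of its inequalities is redundant. -/
  minimal : ∀ i, ∃ x, (∀ k, k ≠ i → (D.T *ᵥ x) k ≤ 1) ∧ 1 < (D.T *ᵥ x) i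
  /-- `U j` solves the `nx` equalities with index in `Ract j`: `[T]_i U_j = [I]_i`. -/
  Ract_card : ∀ j, (D.Ract j).card = nx
  U_active : ∀ j, ∀ i ∈ D.Ract j, (D.T * D.U j) i = (1 : Matrix (Fin na) (Fin na) ℝ) i
  /-- Vertex form of the cross sections, for every `α` all of whose inequalities are attained. -/
  U_vertex : ∀ α : Fin na → ℝ, (∀ i, ∃ x ∈ D.X α, (D.T *ᵥ x) i = α i) →
    D.X α = convexHull ℝ (Set.range fun j => D.U j *ᵥ α)
  Q_pos : D.Q.PosDef
  R_pos : D.R.PosDef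
  N_pos : 0 < D.N
  Nu_pos : 0 < D.Nu
  thbar0_mem : D.thbar0 ∈ D.Theta D.mu0

/-- The tube inclusion condition at one prediction step and one vertex, in multiplier form, for the
vertex `U_j a`, perturbation `v` and successor cross section `a'`. -/
def TubeStep (μ : Fin r → ℝ) (j : Fin m) (a : Fin na → ℝ) (v : Fin nu → ℝ) (a' : Fin na → ℝ)
    (L : Matrix (Fin na) (Fin r) ℝ) : Prop :=
  L * D.Mth = D.T * D.regD (D.U j *ᵥ a) (D.K *ᵥ (D.U j *ᵥ a) + v) ∧
  L *ᵥ μ ≤ a' - D.T *ᵥ D.regd (D.U j *ᵥ a) (D.K *ᵥ (D.U j *ᵥ a) + v) - D.wbar ∧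
  ∀ i l, 0 ≤ L i l

/-- Left-hand side of the linearized persistent excitation condition at one prediction step, for
the reference `(xh, uh)` and the point `(x, u)`. -/
def peLin (xh : Fin nx → ℝ) (uh : Fin nu → ℝ) (x : Fin nx → ℝ) (u : Fin nu → ℝ) :
    Matrix (Fin p) (Fin p) ℝ :=
  (D.regD xh uh)ᵀ * D.regD xh uh + (D.regD (x - xh) (u - uh))ᵀ * D.regD xh uh
    + (D.regD xh uh)ᵀ * D.regD (x - xh) (u - uh)

/-- The constraints of the MPC problem at state `x`, with parameter set `Θ(μ)`, nominal parameter
`θb` and reference sequences `xh`, `uh`. -/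
structure Feasible (x : Fin nx → ℝ) (μ : Fin r → ℝ) (θb : Fin p → ℝ)
    (xh : ℕ → (Fin nx → ℝ)) (uh : ℕ → (Fin nu → ℝ)) (d : MPCDecision nx nu p r na m) : Prop where
  /-- dual mode predictions: no perturbation and constant cross section beyond the horizon -/
  v_tail : ∀ k, D.N ≤ k → d.v k = 0
  α_tail : ∀ k, D.N ≤ k → d.α k = d.α D.N
  initial : D.T *ᵥ x ≤ d.α 0
  state_input : ∀ k, k < D.N → ∀ j,
    (D.F + D.G * D.K) *ᵥ (D.U j *ᵥ d.α k) + D.G *ᵥ d.v k ≤ 1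
  tube : ∀ k, k < D.N → ∀ j, D.TubeStep μ j (d.α k) (d.v k) (d.α (k + 1)) (d.Lam k j)
  term_state_input : ∀ j, (D.F + D.G * D.K) *ᵥ (D.U j *ᵥ d.α D.N) ≤ 1
  term_tube : ∀ j, D.TubeStep μ j (d.α D.N) 0 (d.α D.N) (d.Lam D.N j)
  nom_init : d.xbar 0 = x
  nom_state : ∀ k, d.xbar (k + 1) = D.Phi θb *ᵥ d.xbar k + D.Bth θb *ᵥ d.v k
  nom_input : ∀ k, d.ubar k = D.K *ᵥ d.xbar k + d.v k
  pe_step : ∀ k, k < D.Nu → ∀ j,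
    (D.peLin (xh k) (uh k) (D.U j *ᵥ d.α k) (D.K *ᵥ (D.U j *ᵥ d.α k) + d.v k)
      - d.Mpe k).PosSemidef
  pe_sum : (∑ k ∈ Finset.range D.Nu, d.Mpe k
    - d.beta • (1 : Matrix (Fin p) (Fin p) ℝ)).PosSemidef

/-- The objective of the MPC problem. -/
def objective (θb : Fin p → ℝ) (d : MPCDecision nx nu p r na m) : ℝ :=
  (∑ k ∈ Finset.range D.N, (wsq D.Q (d.xbar k) + wsq D.R (d.ubar k)))
    + wsq (D.lyapP θb) (d.xbar D.N) - D.gam * d.beta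

/-- `d` is an optimal solution of the MPC problem. -/
def IsSolution (x : Fin nx → ℝ) (μ : Fin r → ℝ) (θb : Fin p → ℝ)
    (xh : ℕ → (Fin nx → ℝ)) (uh : ℕ → (Fin nu → ℝ)) (d : MPCDecision nx nu p r na m) : Prop :=
  D.Feasible x μ θb xh uh d ∧
    ∀ d', D.Feasible x μ θb xh uh d' → D.objective θb d ≤ D.objective θb d'

/-- The set of initial states at which the MPC problem is feasible. -/
def XP : Set (Fin nx → ℝ) :=
  {x | ∃ d, D.Feasible x D.mu0 D.thbar0 (D.refx0 x) (D.refu0 x) d}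

/-- Parameters in `Θ_s` that are consistent with the (at most `Nu`) latest transitions up to
time `s + 1`. -/
def consistentSet (τ : MPCSignals nx nu p r na m) (s : ℕ) : Set (Fin p → ℝ) :=
  {θ | θ ∈ D.Theta (τ.mu s) ∧
    ∀ i, i < s + 1 → s + 1 ≤ i + D.Nu → θ ∈ D.Delta (τ.x (i + 1)) (τ.x i) (τ.u i)}

/-- The closed loop signals at time `0`. -/
structure InitOK (τ : MPCSignals nx nu p r na m) : Prop where
  mu : τ.mu 0 = D.mu0
  thbar : τ.thbar 0 = D.thbar0
  xhat : τ.xhat 0 = D.refx0 (τ.x 0)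
  uhat : τ.uhat 0 = D.refu0 (τ.x 0)

/-- One closed loop step from time `s` to `s + 1`, with true parameter `θs` and disturbance `w`:
the MPC problem is solved at time `s`, its first input is applied, and the parameter set, the
nominal parameter and the reference sequences are updated at time `s + 1`. -/
structure StepOK (θs : Fin p → ℝ) (w : ℕ → (Fin nx → ℝ)) (τ : MPCSignals nx nu p r na m)
    (s : ℕ) : Prop where
  solve : D.IsSolution (τ.x s) (τ.mu s) (τ.thbar s) (τ.xhat s) (τ.uhat s) (τ.dec s)
  input : τ.u s = D.K *ᵥ τ.x s + (τ.dec s).v 0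
  plant : τ.x (s + 1) = D.Ath θs *ᵥ τ.x s + D.Bth θs *ᵥ τ.u s + w s
  /-- `Θ_{s+1}` is the smallest set of the form `Θ(μ)` that contains the consistent set, with
  every entry of the right-hand side as small as possible. -/
  mu : IsLeast {μ | D.consistentSet τ s ⊆ D.Theta μ} (τ.mu (s + 1))
  /-- the nominal parameter is projected onto `Θ_{s+1}` -/
  thbar_mem : τ.thbar (s + 1) ∈ D.Theta (τ.mu (s + 1))
  thbar_min : ∀ θ ∈ D.Theta (τ.mu (s + 1)),
    l2norm (τ.thbar s - τ.thbar (s + 1)) ≤ l2norm (τ.thbar s - θ)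
  xhat_zero : τ.xhat (s + 1) 0 = τ.x (s + 1)
  xhat_succ : ∀ k, τ.xhat (s + 1) (k + 1) =
    D.Ath (τ.thbar (s + 1)) *ᵥ τ.xhat (s + 1) k + D.Bth (τ.thbar (s + 1)) *ᵥ τ.uhat (s + 1) k
  uhat : ∀ k, τ.uhat (s + 1) k = D.K *ᵥ τ.xhat (s + 1) k + (τ.dec s).v (k + 1)

/-- `τ` is a closed loop run up to time `t`: the steps `0 → 1, …, t - 1 → t` obey the algorithm. -/
def RunTo (θs : Fin p → ℝ) (w : ℕ → (Fin nx → ℝ)) (τ : MPCSignals nx nu p r na m)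
    (t : ℕ) : Prop :=
  D.InitOK τ ∧ ∀ s, s < t → D.StepOK θs w τ s

/-- Well-posedness of the closed loop from every state in `S`, for all parameters in `Θ_0` and all
disturbances in `𝒲`: runs exist for all times, and on every run the MPC problem always has an
optimal solution. -/
def WellPosed (S : Set (Fin nx → ℝ)) : Prop :=
  ∀ θs ∈ D.Theta D.mu0, ∀ w : ℕ → (Fin nx → ℝ), (∀ t, w t ∈ D.W) →
    (∀ x0 ∈ S, ∃ τ, τ.x 0 = x0 ∧ ∀ t, D.RunTo θs w τ t) ∧
    ∀ τ t, τ.x 0 ∈ S → D.RunTo θs w τ t →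
      ∃ d, D.IsSolution (τ.x t) (τ.mu t) (τ.thbar t) (τ.xhat t) (τ.uhat t) d

/-- The constraints `F x_t + G u_t ≤ 1` hold on all runs from `S`, for all parameters in `Θ_0` and
all disturbances in `𝒲`. -/
def RobustConstraints (S : Set (Fin nx → ℝ)) : Prop :=
  ∀ θs ∈ D.Theta D.mu0, ∀ w : ℕ → (Fin nx → ℝ), (∀ t, w t ∈ D.W) →
    ∀ τ t, τ.x 0 ∈ S → D.RunTo θs w τ (t + 1) → (τ.x t, τ.u t) ∈ D.Z

/-- Input-to-state stability with region of attraction `S`, with respect to the disturbance and the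
nominal parameter error. The suprema are over `k = 0, …, t - 1` (and `0` for `t = 0`). -/
def IsISS (S : Set (Fin nx → ℝ)) : Prop :=
  (0 : Fin nx → ℝ) ∈ interior S ∧
  ∃ (η : ℝ → ℝ → ℝ) (ψ ζ : ℝ → ℝ), IsClassKL η ∧ IsClassK ψ ∧ IsClassK ζ ∧
    ∀ θs ∈ D.Theta D.mu0, ∀ w : ℕ → (Fin nx → ℝ), (∀ t, w t ∈ D.W) →
      ∀ τ t, τ.x 0 ∈ S → D.RunTo θs w τ t →
        l2norm (τ.x t) ≤ η (l2norm (τ.x 0)) t + ψ (⨆ k : Fin t, l2norm (w k))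
          + ζ (⨆ k : Fin t, l2norm (τ.thbar k - θs))

end MPCData

end

/-! With `γ = 0` the objective ignores the excitation level, and the excitation constraints can
always be met by taking `M_k = -c_k I` with `c_k` large and `β = -∑ c_k`. So the references never
matter: the problem amounts to minimizing `cost` over the pairs `(v, α)` in `TubeFeasible`, where
the multipliers are only required to exist. This set is closed, since the admissible multiplier data
form a finitely generated cone (`isClosed_finset_cone`, `isClosed_tubeStep`), and bounded, since `𝒵`
is bounded and every entry of `α` is read off at some vertex (`exists_active`). Hence a feasible
problem has an optimal solution.

The vertex description is assumed only for tight `α`, while the optimizer may choose a tube that is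
not tight. What survives is the inclusion `X_subset_hull`, and it suffices: inequalities imposed at
the points `U_j α` hold on the whole cross section. Together with weak duality for the multipliers,
this makes the tube contain every successor state, so the shifted solution stays feasible
(`TubeFeasible.shift`). The true parameter stays in every parameter set and these sets shrink, so
runs continue forever and respect the constraints.

For stability the optimal cost serves as a Lyapunov function. Below it dominates `‖x‖_Q²`. Above it
is at most a multiple of `‖x‖²`: near the origin zero perturbations are feasible with a constant
tube (`exists_terminal_ball`), and elsewhere the cost is bounded. Along nominal predictions the
shifted cost drops by the stage cost, because `P(θ)` is the exact infinite-horizon cost matrix. The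
real successor state and the updated nominal parameter differ from the nominal ones by `O(‖w_t‖ +
‖θ̄_t - θ*‖)`, where the projection bounds the move of `θ̄`. The cost is Lipschitz in both, so it
decreases up to that error (`exists_decrease`). Geometric decay with an additive error follows, and
square roots give the estimate. -/

/-! ### Closedness of finitely generated cones -/

/-- A finitely generated cone in a finite dimensional space is closed. -/
theorem isClosed_finset_cone {ι E : Type*} [NormedAddCommGroup E] [NormedSpace ℝ E]
    [FiniteDimensional ℝ E] (g : ι → E) (s : Finset ι) :
    IsClosed {y | ∃ c : ι → ℝ, (∀ i, 0 ≤ c i) ∧ ∑ i ∈ s, c i • g i = y} := by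
  classical
  induction s using Finset.strongInduction with
  | H s ih =>
  by_cases hli : LinearIndependent ℝ (fun i : s => g i)
  -- For independent generators the cone is the image of the nonnegative orthant under a closed
  -- embedding.
  · have hinj : Function.Injective (Fintype.linearCombination ℝ (fun i : s => g i)) :=
      hli.fintypeLinearCombination_injective
    have hemb := LinearMap.isClosedEmbedding_of_injective (𝕜 := ℝ) (LinearMap.ker_eq_bot.2 hinj)
    have hcl := hemb.isClosedMap _ (isClosed_Ici (a := (0 : s → ℝ)))
    convert hcl using 1
    ext y
    constructor
    · rintro ⟨c, hc, rfl⟩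
      refine ⟨fun i => c i, fun i => hc i, ?_⟩
      rw [Fintype.linearCombination_apply]
      exact Finset.sum_coe_sort s (fun i => c i • g i)
    · rintro ⟨c, hc, rfl⟩
      refine ⟨fun i => if h : i ∈ s then c ⟨i, h⟩ else 0, fun i => ?_, ?_⟩
      · dsimp only
        split_ifs with h
        · exact hc _
        · exact le_rfl
      · rw [Fintype.linearCombination_apply, ← Finset.sum_coe_sort s]
        exact Finset.sum_congr rfl fun i _ => by simp
  -- Conic Carathéodory: a linear dependence, with its sign chosen so that some coefficient is
  -- positive, allows one generator to be dropped, so the cone is a finite union of smaller cones.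
  · obtain ⟨d, hd0, hdpos⟩ : ∃ d : ι → ℝ, ∑ i ∈ s, d i • g i = 0 ∧ ∃ i ∈ s, 0 < d i := by
      obtain ⟨d, hd, i, hi⟩ := Fintype.not_linearIndependent_iff.1 hli
      have key : ∀ e : s → ℝ, ∑ i, e i • g i = 0 → 0 < e i →
          ∃ d : ι → ℝ, ∑ i ∈ s, d i • g i = 0 ∧ ∃ i ∈ s, 0 < d i := by
        intro e he hpos
        refine ⟨fun i => if h : i ∈ s then e ⟨i, h⟩ else 0, ?_, i, i.2, by simpa using hpos⟩
        rw [← Finset.sum_coe_sort s, ← he]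
        exact Finset.sum_congr rfl fun i _ => by simp
      rcases lt_or_gt_of_ne hi with h | h
      · exact key (-d) (by simpa [neg_smul, Finset.sum_neg_distrib] using hd) (by simpa using h)
      · exact key d hd h
    have hset : {y | ∃ c : ι → ℝ, (∀ i, 0 ≤ c i) ∧ ∑ i ∈ s, c i • g i = y} =
        ⋃ i ∈ s, {y | ∃ c : ι → ℝ, (∀ i, 0 ≤ c i) ∧ ∑ i ∈ s.erase i, c i • g i = y} := by
      ext y
      simp only [mem_iUnion, mem_ofPred_eq, exists_prop]
      constructor
      · rintro ⟨c, hc, rfl⟩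
        -- The minimal ratio marks the coefficient that vanishes first when `c` moves in direction
        -- `-d`; the others are still nonnegative then.
        obtain ⟨i₀, hi₀, hmin⟩ := Finset.exists_min_image (s.filter fun i => 0 < d i)
          (fun i => c i / d i) (by
            obtain ⟨i, hi, h⟩ := hdpos
            exact ⟨i, Finset.mem_filter.2 ⟨hi, h⟩⟩)
        obtain ⟨hi₀s, hi₀d⟩ := Finset.mem_filter.1 hi₀
        have hcs : ∀ i ∈ s, 0 ≤ c i - c i₀ / d i₀ * d i := by
          intro i hi
          rcases lt_or_ge 0 (d i) with h | h
          · have := hmin i (Finset.mem_filter.2 ⟨hi, h⟩)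
            have := (le_div_iff₀ h).1 this
            linarith
          · have := mul_nonpos_of_nonneg_of_nonpos (div_nonneg (hc i₀) hi₀d.le) h
            linarith [hc i]
        refine ⟨i₀, hi₀s, fun i => if i ∈ s then c i - c i₀ / d i₀ * d i else 0, fun i => ?_, ?_⟩
        · dsimp only
          split_ifs with h
          · exact hcs i h
          · exact le_rfl
        · have h1 : ∑ i ∈ s, (c i - c i₀ / d i₀ * d i) • g i = ∑ i ∈ s, c i • g i := by
            simp only [sub_smul, mul_smul, Finset.sum_sub_distrib, ← Finset.smul_sum, hd0]
            simp
          rw [← h1, ← Finset.add_sum_erase s _ hi₀s]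
          rw [div_mul_cancel₀ _ hi₀d.ne', sub_self, zero_smul, zero_add]
          refine Finset.sum_congr rfl fun i hi => ?_
          simp only [if_pos (Finset.mem_of_mem_erase hi)]
      · rintro ⟨i, hi, c, hc, rfl⟩
        refine ⟨fun k => if k = i then 0 else c k, fun k => ?_, ?_⟩
        · dsimp only
          split_ifs
          · exact le_rfl
          · exact hc k
        · rw [← Finset.add_sum_erase s _ hi]
          simp only [if_true, zero_smul, zero_add]
          exact Finset.sum_congr rfl fun k hk => by rw [if_neg (Finset.ne_of_mem_erase hk)]
    rw [hset]
    exact s.finite_toSet.isClosed_biUnion fun i hi => ih _ (Finset.erase_ssubset hi)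

/-! ### Norm comparisons and quadratic forms -/

theorem norm_le_l2norm {n : ℕ} (a : Fin n → ℝ) : ‖a‖ ≤ l2norm a :=
  (pi_norm_le_iff_of_nonneg (norm_nonneg _)).2 fun i =>
    PiLp.norm_apply_le (WithLp.toLp 2 a : EuclideanSpace ℝ (Fin n)) i

theorem l2norm_nonneg {n : ℕ} (a : Fin n → ℝ) : 0 ≤ l2norm a := norm_nonneg _

theorem l2norm_sq_le {n : ℕ} (a : Fin n → ℝ) : l2norm a ^ 2 ≤ n * ‖a‖ ^ 2 := by
  rw [l2norm, EuclideanSpace.norm_sq_eq]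
  calc ∑ i, ‖a i‖ ^ 2 ≤ ∑ _i : Fin n, ‖a‖ ^ 2 :=
        Finset.sum_le_sum fun i _ => pow_le_pow_left₀ (norm_nonneg _) (norm_le_pi_norm a i) 2
    _ = n * ‖a‖ ^ 2 := by simp

theorem continuous_l2norm {n : ℕ} : Continuous (l2norm : (Fin n → ℝ) → ℝ) :=
  (PiLp.continuous_toLp 2 _).norm

theorem exists_mulVec_bound {k l : ℕ} (M : Matrix (Fin k) (Fin l) ℝ) :
    ∃ C, 0 ≤ C ∧ ∀ x, ‖M *ᵥ x‖ ≤ C * ‖x‖ := by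
  let _ := Matrix.linftyOpNormedAddCommGroup (m := Fin k) (n := Fin l) (α := ℝ)
  exact ⟨‖M‖, norm_nonneg _, fun x => Matrix.linfty_opNorm_mulVec M x⟩

theorem abs_dotProduct_le {n : ℕ} (x y : Fin n → ℝ) : |x ⬝ᵥ y| ≤ n * (‖x‖ * ‖y‖) := by
  calc |∑ i, x i * y i| ≤ ∑ i, |x i * y i| := Finset.abs_sum_le_sum_abs _ _
    _ ≤ ∑ _i : Fin n, ‖x‖ * ‖y‖ := by
        refine Finset.sum_le_sum fun i _ => ?_
        rw [abs_mul]
        exact mul_le_mul (norm_le_pi_norm x i) (norm_le_pi_norm y i) (abs_nonneg _) (norm_nonneg _)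
    _ = n * (‖x‖ * ‖y‖) := by simp

theorem exists_bilin_bound {n : ℕ} (P : Matrix (Fin n) (Fin n) ℝ) :
    ∃ C, 0 ≤ C ∧ ∀ x y, |x ⬝ᵥ (P *ᵥ y)| ≤ C * (‖x‖ * ‖y‖) := by
  obtain ⟨C, hC, h⟩ := exists_mulVec_bound P
  refine ⟨n * C, by positivity, fun x y => (abs_dotProduct_le _ _).trans ?_⟩
  have := mul_le_mul_of_nonneg_left (h y) (norm_nonneg x)
  calc (n : ℝ) * (‖x‖ * ‖P *ᵥ y‖) ≤ n * (‖x‖ * (C * ‖y‖)) := by gcongr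
    _ = n * C * (‖x‖ * ‖y‖) := by ring

/-- Affine matrix families depend Lipschitz continuously on their parameter. -/
theorem exists_affine_family_lipschitz {k l p : ℕ} (M₀ : Matrix (Fin k) (Fin l) ℝ)
    (M : Fin p → Matrix (Fin k) (Fin l) ℝ) :
    ∃ C, 0 ≤ C ∧ ∀ (θ θ' : Fin p → ℝ) (x : Fin l → ℝ),
      ‖(M₀ + ∑ i, θ i • M i) *ᵥ x - (M₀ + ∑ i, θ' i • M i) *ᵥ x‖ ≤ C * (‖θ - θ'‖ * ‖x‖) := by
  choose C hC h using fun i => exists_mulVec_bound (M i)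
  refine ⟨∑ i, C i, Finset.sum_nonneg fun i _ => hC i, fun θ θ' x => ?_⟩
  have : (M₀ + ∑ i, θ i • M i) *ᵥ x - (M₀ + ∑ i, θ' i • M i) *ᵥ x
      = ∑ i, (θ - θ') i • (M i *ᵥ x) := by
    simp only [add_mulVec, Matrix.sum_mulVec, smul_mulVec, add_sub_add_left_eq_sub,
      ← Finset.sum_sub_distrib, Pi.sub_apply, sub_smul]
  rw [this, Finset.sum_mul]
  refine (norm_sum_le _ _).trans (Finset.sum_le_sum fun i _ => ?_)
  rw [norm_smul]
  calc ‖(θ - θ') i‖ * ‖M i *ᵥ x‖ ≤ ‖θ - θ'‖ * (C i * ‖x‖) :=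
        mul_le_mul (norm_le_pi_norm _ i) (h i x) (norm_nonneg _) (norm_nonneg _)
    _ = C i * (‖θ - θ'‖ * ‖x‖) := by ring

theorem wsq_smul {n : ℕ} (P : Matrix (Fin n) (Fin n) ℝ) (c : ℝ) (x : Fin n → ℝ) :
    wsq P (c • x) = c ^ 2 * wsq P x := by
  simp only [wsq, mulVec_smul, dotProduct_smul, smul_dotProduct, smul_eq_mul]
  ring

theorem continuous_wsq {n : ℕ} (P : Matrix (Fin n) (Fin n) ℝ) : Continuous (wsq P) := by
  unfold wsq; fun_prop

theorem Matrix.PosDef.wsq_pos {n : ℕ} {P : Matrix (Fin n) (Fin n) ℝ} (hP : P.PosDef)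
    {x : Fin n → ℝ} (hx : x ≠ 0) : 0 < wsq P x := by
  simpa [wsq] using hP.dotProduct_mulVec_pos hx

theorem Matrix.PosDef.wsq_nonneg {n : ℕ} {P : Matrix (Fin n) (Fin n) ℝ} (hP : P.PosDef)
    (x : Fin n → ℝ) : 0 ≤ wsq P x := by
  rcases eq_or_ne x 0 with rfl | hx
  · simp [wsq]
  · exact (hP.wsq_pos hx).le

theorem Matrix.PosDef.exists_wsq_lower_bound {n : ℕ} {P : Matrix (Fin n) (Fin n) ℝ}
    (hP : P.PosDef) : ∃ c, 0 < c ∧ ∀ x, c * l2norm x ^ 2 ≤ wsq P x := by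
  rcases Set.eq_empty_or_nonempty (Metric.sphere (0 : Fin n → ℝ) 1) with h | h
  · refine ⟨1, one_pos, fun x => ?_⟩
    have hx : x = 0 := by
      by_contra hx
      have : ‖x‖⁻¹ • x ∈ Metric.sphere (0 : Fin n → ℝ) 1 := by
        simp [norm_smul, inv_mul_cancel₀ (norm_ne_zero_iff.2 hx)]
      simp [h] at this
    subst hx
    simp [wsq, l2norm]
  · obtain ⟨x₀, hx₀, hmin⟩ :=
      (isCompact_sphere (0 : Fin n → ℝ) 1).exists_isMinOn h (continuous_wsq P).continuousOn
    have hx₀0 : x₀ ≠ 0 := by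
      rintro rfl
      simp at hx₀
    have hpos := hP.wsq_pos hx₀0
    -- The minimum on the unit sphere of the sup norm, divided by the factor that converts to the
    -- Euclidean norm; `n + 1` in place of `n` keeps the denominator positive.
    refine ⟨wsq P x₀ / (n + 1), by positivity, fun x => ?_⟩
    have h1 : wsq P x₀ * ‖x‖ ^ 2 ≤ wsq P x := by
      rcases eq_or_ne x 0 with rfl | hx
      · simp [wsq]
      have hn := norm_ne_zero_iff.2 hx
      have hm : ‖x‖⁻¹ • x ∈ Metric.sphere (0 : Fin n → ℝ) 1 := by
        simp [norm_smul, inv_mul_cancel₀ hn]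
      have := hmin hm
      simp only [mem_ofPred_eq, wsq_smul] at this
      calc wsq P x₀ * ‖x‖ ^ 2 ≤ ‖x‖⁻¹ ^ 2 * wsq P x * ‖x‖ ^ 2 := by gcongr
        _ = wsq P x := by field_simp
    refine le_trans ?_ h1
    rw [div_mul_eq_mul_div, div_le_iff₀ (by positivity), mul_assoc]
    refine mul_le_mul_of_nonneg_left ((l2norm_sq_le x).trans ?_) hpos.le
    nlinarith [sq_nonneg ‖x‖]

/-! ### Geometry of the tube cross sections -/

namespace MPCData

variable {nx nu p nc nw r na m : ℕ} {D : MPCData nx nu p nc nw r na m}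

/-- The facets of `{x | T x ≤ 1}` remain attained when the right-hand side grows a little. -/
theorem Assumptions.exists_attained (hD : D.Assumptions) : ∃ ε : ℝ, 0 < ε ∧ ∀ α : Fin na → ℝ,
    (∀ i, 1 ≤ α i ∧ α i ≤ 1 + ε) → ∀ i, ∃ x ∈ D.X α, (D.T *ᵥ x) i = α i := by
  choose x hx1 hx2 using hD.minimal
  obtain ⟨ε, hε⟩ := (Filter.eventually_all.2 fun i =>
    Ioc_mem_nhdsGT (sub_pos.2 (hx2 i))).and self_mem_nhdsWithin |>.exists
  refine ⟨ε, hε.2, fun α hα i => ?_⟩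
  have hpos : 0 < (D.T *ᵥ x i) i := one_pos.trans (hx2 i)
  have hs1 : α i / (D.T *ᵥ x i) i ≤ 1 := by
    rw [div_le_one hpos]
    linarith [(hα i).2, (hε.1 i).2]
  have hs0 : 0 ≤ α i / (D.T *ᵥ x i) i := div_nonneg (by linarith [(hα i).1]) hpos.le
  refine ⟨(α i / (D.T *ᵥ x i) i) • x i, fun k => ?_, ?_⟩
  · rw [mulVec_smul, Pi.smul_apply, smul_eq_mul]
    rcases eq_or_ne k i with rfl | hk
    · rw [div_mul_cancel₀ _ hpos.ne']
    · calc _ ≤ α i / (D.T *ᵥ x i) i * 1 := mul_le_mul_of_nonneg_left (hx1 i k hk) hs0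
        _ ≤ α k := by linarith [(hα k).1]
  · rw [mulVec_smul, Pi.smul_apply, smul_eq_mul, div_mul_cancel₀ _ hpos.ne']

theorem Assumptions.X_one_eq (hD : D.Assumptions) :
    D.X 1 = convexHull ℝ (range fun j => D.U j *ᵥ 1) := by
  obtain ⟨ε, hε, h⟩ := hD.exists_attained
  exact hD.U_vertex 1 (h 1 fun i => ⟨le_rfl, by simp [hε.le]⟩)

theorem Assumptions.nonempty_vertices (hD : D.Assumptions) : Nonempty (Fin m) := by
  have h0 : (0 : Fin nx → ℝ) ∈ D.X 1 := by simp [X]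
  rw [hD.X_one_eq] at h0
  exact range_nonempty_iff_nonempty.1 (convexHull_nonempty_iff.1 ⟨0, h0⟩)

/-- The active rows form a square block of `T`. The corresponding columns of `U j` are a right
inverse of it, hence also a left inverse, so the block is injective. -/
theorem Assumptions.eq_zero_of_active (hD : D.Assumptions) (j : Fin m) {y : Fin nx → ℝ}
    (hy : ∀ k ∈ D.Ract j, (D.T *ᵥ y) k = 0) : y = 0 := by
  let e : Fin nx ≃ D.Ract j := (Finset.equivFinOfCardEq (hD.Ract_card j)).symm
  let TR : Matrix (Fin nx) (Fin nx) ℝ := D.T.submatrix (fun a => (e a : Fin na)) id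
  let UR : Matrix (Fin nx) (Fin nx) ℝ := (D.U j).submatrix id (fun a => (e a : Fin na))
  have h1 : TR * UR = 1 := by
    ext a b
    have := congrFun (hD.U_active j (e a) (e a).2) (e b)
    simp only [mul_apply] at this
    simp only [mul_apply, TR, UR, submatrix_apply, id]
    rw [this, one_apply, one_apply]
    simp
  have h2 : UR * TR = 1 := mul_eq_one_comm.1 h1
  have h3 : TR *ᵥ y = 0 := by
    ext a
    exact hy _ (e a).2
  rw [← one_mulVec y, ← h2, ← mulVec_mulVec, h3, mulVec_zero]

theorem Assumptions.T_mulVec_U (hD : D.Assumptions) {j : Fin m} {i : Fin na} (hi : i ∈ D.Ract j)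
    (α : Fin na → ℝ) : (D.T *ᵥ (D.U j *ᵥ α)) i = α i := by
  have h := hD.U_active j i hi
  rw [mulVec_mulVec, mulVec, h]
  exact congrFun (one_mulVec α) i

theorem Assumptions.U_mulVec_T (hD : D.Assumptions) (j : Fin m) (x : Fin nx → ℝ) :
    D.U j *ᵥ (D.T *ᵥ x) = x := by
  rw [← sub_eq_zero]
  refine hD.eq_zero_of_active j fun k hk => ?_
  rw [mulVec_sub, Pi.sub_apply, hD.T_mulVec_U hk, sub_self]

/-- Otherwise raising only the `i`-th entry of the right-hand side would move no vertex, although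
inequality `i` is still attained at its larger value. -/
theorem Assumptions.exists_active (hD : D.Assumptions) (i : Fin na) : ∃ j, i ∈ D.Ract j := by
  by_contra! hi
  obtain ⟨ε, hε, h⟩ := hD.exists_attained
  have hatt := h (1 + Pi.single i ε) fun k => by
    rcases eq_or_ne k i with rfl | hk
    · simp [hε.le]
    · simp [hk, hε.le]
  have hU : ∀ j, D.U j *ᵥ (Pi.single i ε) = 0 := fun j =>
    hD.eq_zero_of_active j fun k hk => by
      rw [hD.T_mulVec_U hk, Pi.single_eq_of_ne]
      rintro rfl
      exact hi j hk
  obtain ⟨x, hx, hxi⟩ := hatt i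
  rw [hD.U_vertex _ hatt] at hx
  simp only [mulVec_add, hU, add_zero] at hx
  rw [← hD.X_one_eq] at hx
  have := hx i
  rw [hxi] at this
  simp at this
  linarith

/-- Since each index is active at some vertex, `α i` is a row of `T` applied to that vertex. This is
what bounds the tube parameters of feasible decisions. -/
theorem Assumptions.exists_tube_bound (hD : D.Assumptions) : ∃ C, 0 ≤ C ∧
    ∀ (α : Fin na → ℝ) (ρ : ℝ), 0 ≤ ρ → (∀ j, ‖D.U j *ᵥ α‖ ≤ ρ) → ‖α‖ ≤ C * ρ := by
  obtain ⟨C, hC, h⟩ := exists_mulVec_bound D.T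
  refine ⟨C, hC, fun α ρ hρ hj => (pi_norm_le_iff_of_nonneg (by positivity)).2 fun i => ?_⟩
  obtain ⟨j, hij⟩ := hD.exists_active i
  rw [← hD.T_mulVec_U hij α]
  exact (norm_le_pi_norm _ i).trans ((h _).trans (mul_le_mul_of_nonneg_left (hj j) hC))

/-- If a functional `f` were positive on all `U_j β`, then passing from `1` to the larger right-hand
side `1 + cβ` would raise `f` at every vertex. The polytope only grows, however, so it still
contains the old minimizer of `f`. -/
theorem Assumptions.zero_mem_hull (hD : D.Assumptions) {β : Fin na → ℝ} (hβ : 0 ≤ β) :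
    (0 : Fin nx → ℝ) ∈ convexHull ℝ (range fun j => D.U j *ᵥ β) := by
  by_contra h0
  have : Nonempty (Fin m) := hD.nonempty_vertices
  obtain ⟨f, u, hu, hf⟩ := geometric_hahn_banach_point_closed (convex_convexHull ℝ _)
    ((finite_range fun j => D.U j *ᵥ β).isClosed_convexHull ℝ) h0
  have hpos : ∀ j, 0 < f (D.U j *ᵥ β) := fun j => by
    have := hf _ (subset_convexHull ℝ _ (mem_range_self j))
    rw [map_zero] at hu
    linarith
  obtain ⟨ε, hε, hatt⟩ := hD.exists_attained
  obtain ⟨j₀, hj₀⟩ := Finite.exists_min fun j => f (D.U j *ᵥ 1)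
  -- Small enough that `1 + cβ` stays between `1` and `1 + ε`, where all inequalities are attained
  -- and the vertex form applies.
  set c := ε / (‖β‖ + 1)
  have hc : 0 < c := by positivity
  have hcβ : ∀ i, 0 ≤ c * β i ∧ c * β i ≤ ε := fun i => by
    refine ⟨mul_nonneg hc.le (hβ i), ?_⟩
    have : β i ≤ ‖β‖ := (le_abs_self _).trans (norm_le_pi_norm β i)
    rw [div_mul_eq_mul_div, div_le_iff₀ (by positivity)]
    exact mul_le_mul_of_nonneg_left (by linarith) hε.le
  have hx : D.U j₀ *ᵥ 1 ∈ D.X (1 + c • β) := by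
    have : D.U j₀ *ᵥ 1 ∈ D.X 1 := by
      rw [hD.X_one_eq]
      exact subset_convexHull ℝ _ (mem_range_self j₀)
    intro i
    have h1 := this i
    have h2 := (hcβ i).1
    simp only [Pi.add_apply, Pi.smul_apply, smul_eq_mul]
    linarith
  rw [hD.U_vertex _ (hatt _ fun i => by
    have := hcβ i
    simp only [Pi.add_apply, Pi.smul_apply, smul_eq_mul, Pi.one_apply]
    constructor <;> linarith)] at hx
  have hsub : convexHull ℝ (range fun j => D.U j *ᵥ (1 + c • β)) ⊆
      {y | f (D.U j₀ *ᵥ 1) < f y} := by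
    refine convexHull_min ?_ (convex_halfSpace_gt f.isLinear _)
    rintro _ ⟨j, rfl⟩
    simp only [mem_ofPred_eq, mulVec_add, mulVec_smul, map_add, map_smul, smul_eq_mul]
    have := hj₀ j
    have := mul_pos hc (hpos j)
    linarith
  exact lt_irrefl (f (D.U j₀ *ᵥ 1)) (hsub hx)

/-- Every cross section, tight or not, is covered by the hull of its vertex maps. -/
theorem Assumptions.X_subset_hull (hD : D.Assumptions) (α : Fin na → ℝ) :
    D.X α ⊆ convexHull ℝ (range fun j => D.U j *ᵥ α) := by
  intro x hx
  -- The slack of `x` is a nonnegative right-hand side. As `U_j T x = x`, translating its hull by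
  -- `x` gives the hull for `α`.
  have h0 := hD.zero_mem_hull (β := α - D.T *ᵥ x) (sub_nonneg.2 hx)
  have hsub : convexHull ℝ (range fun j => D.U j *ᵥ (α - D.T *ᵥ x)) ⊆
      (fun y => y + x) ⁻¹' convexHull ℝ (range fun j => D.U j *ᵥ α) := by
    refine convexHull_min ?_ ((convex_convexHull ℝ _).translate_preimage_left x)
    rintro _ ⟨j, rfl⟩
    simp only [mem_preimage, mulVec_sub, hD.U_mulVec_T, sub_add_cancel]
    exact subset_convexHull ℝ _ (mem_range_self j)
  simpa using hsub h0

/-- Affine inequalities that hold at all vertices hold on the cross section. -/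
theorem Assumptions.mulVec_le_of_vertices (hD : D.Assumptions) {k : ℕ} {α : Fin na → ℝ}
    (M : Matrix (Fin k) (Fin nx) ℝ) (b : Fin k → ℝ) (h : ∀ j, M *ᵥ (D.U j *ᵥ α) ≤ b)
    {x : Fin nx → ℝ} (hx : x ∈ D.X α) : M *ᵥ x ≤ b := by
  have hsub : convexHull ℝ (range fun j => D.U j *ᵥ α) ⊆ M.mulVecLin ⁻¹' Iic b := by
    refine convexHull_min ?_ ((convex_Iic b).linear_preimage _)
    rintro _ ⟨j, rfl⟩
    exact h j
  exact hsub (hD.X_subset_hull α hx)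

end MPCData

/-! ### Discrete Lyapunov equations -/

theorem dotProduct_conj_mulVec {n : ℕ} (Φ P : Matrix (Fin n) (Fin n) ℝ) (x y : Fin n → ℝ) :
    x ⬝ᵥ ((Φᵀ * P * Φ) *ᵥ y) = (Φ *ᵥ x) ⬝ᵥ (P *ᵥ (Φ *ᵥ y)) := by
  rw [← mulVec_mulVec, ← mulVec_mulVec, dotProduct_mulVec, vecMul_transpose]

/-- The solution of a discrete Lyapunov equation is bounded by its right-hand side. -/
theorem abs_lyapunov_le {n : ℕ} {Φ P E : Matrix (Fin n) (Fin n) ℝ} {c lam e : ℝ}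
    (hlam0 : 0 ≤ lam) (hlam1 : lam < 1) (he : 0 ≤ e)
    (hΦ : ∀ k x, ‖(Φ ^ k) *ᵥ x‖ ≤ c * lam ^ k * ‖x‖)
    (hE : ∀ x y, |x ⬝ᵥ (E *ᵥ y)| ≤ e * (‖x‖ * ‖y‖)) (hP : P - Φᵀ * P * Φ = E)
    (x y : Fin n → ℝ) :
    |x ⬝ᵥ (P *ᵥ y)| ≤ e * (c ^ 2 * (1 - lam ^ 2)⁻¹) * (‖x‖ * ‖y‖) := by
  have hstep : ∀ x y, x ⬝ᵥ (P *ᵥ y) = x ⬝ᵥ (E *ᵥ y) + (Φ *ᵥ x) ⬝ᵥ (P *ᵥ (Φ *ᵥ y)) := by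
    intro x y
    rw [← dotProduct_conj_mulVec, ← dotProduct_add, ← add_mulVec, ← hP, sub_add_cancel]
  have hsum : ∀ k, x ⬝ᵥ (P *ᵥ y) = (∑ i ∈ Finset.range k, ((Φ ^ i) *ᵥ x) ⬝ᵥ (E *ᵥ ((Φ ^ i) *ᵥ y)))
      + ((Φ ^ k) *ᵥ x) ⬝ᵥ (P *ᵥ ((Φ ^ k) *ᵥ y)) := by
    intro k
    induction k with
    | zero => simp
    | succ k ih =>
      rw [ih, Finset.sum_range_succ, hstep ((Φ ^ k) *ᵥ x), pow_succ', ← mulVec_mulVec,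
        ← mulVec_mulVec, add_assoc]
  have hprod : ∀ k, ‖(Φ ^ k) *ᵥ x‖ * ‖(Φ ^ k) *ᵥ y‖ ≤ c ^ 2 * (lam ^ 2) ^ k * (‖x‖ * ‖y‖) := by
    intro k
    calc _ ≤ (c * lam ^ k * ‖x‖) * (c * lam ^ k * ‖y‖) :=
          mul_le_mul (hΦ k x) (hΦ k y) (norm_nonneg _) ((norm_nonneg _).trans (hΦ k x))
      _ = _ := by rw [← pow_mul]; ring
  have hl2 : lam ^ 2 < 1 := by nlinarith
  obtain ⟨b, hb, hPb⟩ := exists_bilin_bound P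
  -- Unrolling the equation `k` times leaves a geometric sum and a remainder. The constant `b`
  -- depends on `P`, but it only enters the remainder, which vanishes in the limit.
  have hbound : ∀ k : ℕ, |x ⬝ᵥ (P *ᵥ y)| ≤ e * (c ^ 2 * (1 - lam ^ 2)⁻¹) * (‖x‖ * ‖y‖)
      + b * (c ^ 2 * (lam ^ 2) ^ k * (‖x‖ * ‖y‖)) := by
    intro k
    rw [hsum k]
    refine (abs_add_le _ _).trans (add_le_add ?_ ?_)
    · calc _ ≤ ∑ i ∈ Finset.range k, e * (c ^ 2 * (lam ^ 2) ^ i * (‖x‖ * ‖y‖)) :=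
            (Finset.abs_sum_le_sum_abs _ _).trans (Finset.sum_le_sum fun i _ =>
              (hE _ _).trans (mul_le_mul_of_nonneg_left (hprod i) he))
        _ = e * (c ^ 2 * ∑ i ∈ Finset.range k, (lam ^ 2) ^ i) * (‖x‖ * ‖y‖) := by
            rw [Finset.mul_sum, Finset.mul_sum, Finset.sum_mul]
            exact Finset.sum_congr rfl fun i _ => by ring
        _ ≤ _ := by
            gcongr
            rw [← tsum_geometric_of_lt_one (by positivity) hl2]
            exact (summable_geometric_of_lt_one (by positivity) hl2).sum_le_tsum _
              fun i _ => by positivity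
    · exact (hPb _ _).trans (mul_le_mul_of_nonneg_left (hprod k) hb)
  have hlim : Filter.Tendsto (fun k : ℕ => e * (c ^ 2 * (1 - lam ^ 2)⁻¹) * (‖x‖ * ‖y‖)
      + b * (c ^ 2 * (lam ^ 2) ^ k * (‖x‖ * ‖y‖))) Filter.atTop
      (nhds (e * (c ^ 2 * (1 - lam ^ 2)⁻¹) * (‖x‖ * ‖y‖) + b * (c ^ 2 * 0 * (‖x‖ * ‖y‖)))) :=
    ((((tendsto_pow_atTop_nhds_zero_of_lt_one (by positivity) hl2).const_mul _).mul_const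
      _).const_mul _).const_add _
  simpa using ge_of_tendsto' hlim hbound

/-- The a priori bound with zero right-hand side makes the Lyapunov operator injective, hence
surjective in finite dimension. -/
theorem exists_lyapunov_solution {n : ℕ} {Φ : Matrix (Fin n) (Fin n) ℝ} {c lam : ℝ}
    (hlam0 : 0 ≤ lam) (hlam1 : lam < 1) (hΦ : ∀ k x, ‖(Φ ^ k) *ᵥ x‖ ≤ c * lam ^ k * ‖x‖)
    (S : Matrix (Fin n) (Fin n) ℝ) : ∃ P, P - Φᵀ * P * Φ = S := by
  let L : Matrix (Fin n) (Fin n) ℝ →ₗ[ℝ] Matrix (Fin n) (Fin n) ℝ :=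
    { toFun := fun P => P - Φᵀ * P * Φ
      map_add' := fun P P' => by simp only [mul_add, add_mul]; abel
      map_smul' := fun a P => by simp [smul_sub] }
  have hinj : Function.Injective L := by
    rw [← LinearMap.ker_eq_bot, LinearMap.ker_eq_bot']
    intro P hP
    have := abs_lyapunov_le hlam0 hlam1 le_rfl hΦ (E := 0) (by simp) hP
    ext i j
    simpa using this (Pi.single i 1) (Pi.single j 1)
  exact (LinearMap.injective_iff_surjective.1 hinj) S

/-! ### Uniform stability over the initial parameter set and the terminal cost matrix -/

namespace MPCData

variable {nx nu p nc nw r na m : ℕ} {D : MPCData nx nu p nc nw r na m}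

theorem Phi_mulVec (θ : Fin p → ℝ) (x : Fin nx → ℝ) :
    D.Phi θ *ᵥ x = D.Ath θ *ᵥ x + D.Bth θ *ᵥ (D.K *ᵥ x) := by
  rw [Phi, add_mulVec, ← mulVec_mulVec]

theorem exists_Phi_lipschitz : ∃ C, 0 ≤ C ∧ ∀ θ θ' x,
    ‖D.Phi θ *ᵥ x - D.Phi θ' *ᵥ x‖ ≤ C * (‖θ - θ'‖ * ‖x‖) := by
  obtain ⟨C, hC, h⟩ := exists_affine_family_lipschitz D.A0 D.A
  obtain ⟨C', hC', h'⟩ := exists_affine_family_lipschitz D.B0 D.B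
  obtain ⟨k, hk, hK⟩ := exists_mulVec_bound D.K
  refine ⟨C + C' * k, by positivity, fun θ θ' x => ?_⟩
  rw [Phi_mulVec, Phi_mulVec, add_sub_add_comm]
  refine (norm_add_le _ _).trans ?_
  have h2 := (h' θ θ' (D.K *ᵥ x)).trans (mul_le_mul_of_nonneg_left
    (mul_le_mul_of_nonneg_left (hK x) (norm_nonneg (θ - θ'))) hC')
  calc _ ≤ C * (‖θ - θ'‖ * ‖x‖) + C' * (‖θ - θ'‖ * (k * ‖x‖)) := add_le_add (h θ θ' x) h2
    _ = _ := by ring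

/-- A Lipschitz matrix family is uniformly bounded over a bounded parameter set. -/
theorem exists_family_bound {k l : ℕ} {M : (Fin p → ℝ) → Matrix (Fin k) (Fin l) ℝ}
    (hM : ∃ C, 0 ≤ C ∧ ∀ θ θ' x, ‖M θ *ᵥ x - M θ' *ᵥ x‖ ≤ C * (‖θ - θ'‖ * ‖x‖))
    {S : Set (Fin p → ℝ)} (hS : Bornology.IsBounded S) :
    ∃ C, 0 ≤ C ∧ ∀ θ ∈ S, ∀ x, ‖M θ *ᵥ x‖ ≤ C * ‖x‖ := by
  obtain ⟨C, hC, h⟩ := hM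
  obtain ⟨ρ, hρ0, hρ⟩ := hS.exists_pos_norm_le
  obtain ⟨b, hb, hM0⟩ := exists_mulVec_bound (M 0)
  refine ⟨C * ρ + b, by positivity, fun θ hθ x => ?_⟩
  have h1 := h θ 0 x
  rw [sub_zero] at h1
  have h2 : C * (‖θ‖ * ‖x‖) ≤ C * (ρ * ‖x‖) := by
    have := hρ θ hθ
    gcongr
  calc ‖M θ *ᵥ x‖ = ‖(M θ *ᵥ x - M 0 *ᵥ x) + M 0 *ᵥ x‖ := by rw [sub_add_cancel]
    _ ≤ C * (ρ * ‖x‖) + b * ‖x‖ := (norm_add_le _ _).trans (add_le_add (h1.trans h2) (hM0 x))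
    _ = _ := by ring

/-- Contractivity of the unit cross section is scale invariant, so the entries of `T x` have an
upper bound that shrinks by the factor `lam` at each step. Boundedness of the polytope turns this
into a norm bound, uniform in `θ`. -/
theorem Assumptions.exists_Phi_pow_bound (hD : D.Assumptions) : ∃ c lam : ℝ, 0 ≤ c ∧ 0 < lam ∧
    lam < 1 ∧ ∀ θ ∈ D.Theta D.mu0, ∀ k x, ‖(D.Phi θ ^ k) *ᵥ x‖ ≤ c * lam ^ k * ‖x‖ := by
  obtain ⟨l₀, hl0, hl1, hcon⟩ := hD.contractive
  -- The given factor may be `0`; a slightly larger one is positive, so that scaling by the inverse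
  -- of `lam ^ k` is possible.
  obtain ⟨lam, hll, hlam1⟩ := exists_between hl1
  have hlam : 0 < lam := hl0.trans_lt hll
  obtain ⟨ρ, hρ0, hρ⟩ := hD.X_bounded.exists_pos_norm_le
  obtain ⟨b, hb, hT⟩ := exists_mulVec_bound D.T
  have hscale : ∀ s : ℝ, 0 < s → ∀ x, (∀ i, (D.T *ᵥ x) i ≤ s) → s⁻¹ • x ∈ D.X 1 := by
    intro s hs x hx i
    rw [mulVec_smul, Pi.smul_apply, smul_eq_mul, Pi.one_apply, inv_mul_le_one₀ hs]
    exact hx i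
  refine ⟨ρ * (b + 1), lam, by positivity, hlam, hlam1, fun θ hθ k x => ?_⟩
  rcases eq_or_ne x 0 with rfl | hx
  · simp
  have hs : 0 < (b + 1) * ‖x‖ := by
    have := norm_pos_iff.2 hx
    positivity
  have hind : ∀ k i, (D.T *ᵥ ((D.Phi θ ^ k) *ᵥ x)) i ≤ lam ^ k * ((b + 1) * ‖x‖) := by
    intro k
    induction k with
    | zero =>
      intro i
      have h1 := (le_abs_self _).trans ((norm_le_pi_norm (D.T *ᵥ x) i).trans (hT x))
      simp only [pow_zero, one_mulVec, one_mul]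
      have := norm_nonneg x
      linarith
    | succ k ih =>
      intro i
      have hsk : 0 < lam ^ k * ((b + 1) * ‖x‖) := by positivity
      have := hcon θ hθ _ (hscale _ hsk _ ih) i
      rw [mulVec_smul, mulVec_smul, Pi.smul_apply, smul_eq_mul, inv_mul_le_iff₀ hsk] at this
      rw [pow_succ', ← mulVec_mulVec, pow_succ]
      refine this.trans ?_
      rw [mul_right_comm (lam ^ k) lam]
      exact mul_le_mul_of_nonneg_left hll.le hsk.le
  have hsk : 0 < lam ^ k * ((b + 1) * ‖x‖) := by positivity
  have := hρ _ (hscale _ hsk _ (hind k))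
  rw [norm_smul, norm_inv, Real.norm_of_nonneg hsk.le, inv_mul_le_iff₀ hsk] at this
  refine this.trans (le_of_eq ?_)
  ring

theorem Assumptions.lyapP_spec (hD : D.Assumptions) {θ : Fin p → ℝ} (hθ : θ ∈ D.Theta D.mu0) :
    D.lyapP θ - (D.Phi θ)ᵀ * D.lyapP θ * D.Phi θ = D.Q + D.Kᵀ * D.R * D.K := by
  obtain ⟨c, lam, -, h0, h1, h⟩ := hD.exists_Phi_pow_bound
  exact Classical.epsilon_spec (exists_lyapunov_solution h0.le h1 (h θ hθ) _)

theorem Assumptions.wsq_lyapP (hD : D.Assumptions) {θ : Fin p → ℝ} (hθ : θ ∈ D.Theta D.mu0)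
    (x : Fin nx → ℝ) : wsq (D.lyapP θ) x =
      wsq D.Q x + wsq D.R (D.K *ᵥ x) + wsq (D.lyapP θ) (D.Phi θ *ᵥ x) := by
  have h : D.lyapP θ = D.Q + D.Kᵀ * D.R * D.K + (D.Phi θ)ᵀ * D.lyapP θ * D.Phi θ :=
    sub_eq_iff_eq_add.1 (hD.lyapP_spec hθ)
  conv_lhs => rw [wsq, h]
  simp only [wsq, add_mulVec, dotProduct_add, dotProduct_conj_mulVec]
  rw [← mulVec_mulVec, ← mulVec_mulVec, dotProduct_mulVec x D.Kᵀ, vecMul_transpose]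

theorem Assumptions.exists_lyapP_bound (hD : D.Assumptions) : ∃ C, 0 ≤ C ∧
    ∀ θ ∈ D.Theta D.mu0, ∀ x y, |x ⬝ᵥ (D.lyapP θ *ᵥ y)| ≤ C * (‖x‖ * ‖y‖) := by
  obtain ⟨c, lam, -, h0, h1, h⟩ := hD.exists_Phi_pow_bound
  obtain ⟨e, he, hE⟩ := exists_bilin_bound (D.Q + D.Kᵀ * D.R * D.K)
  have : 0 < 1 - lam ^ 2 := by nlinarith
  exact ⟨_, by positivity, fun θ hθ => abs_lyapunov_le h0.le h1 he (h θ hθ) hE (hD.lyapP_spec hθ)⟩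

/-- The difference of two solutions solves a Lyapunov equation for `Φ(θ)` whose right-hand side is
of order `‖θ - θ'‖`, so the a priori bound applies to it. -/
theorem Assumptions.exists_lyapP_lipschitz (hD : D.Assumptions) : ∃ C, 0 ≤ C ∧
    ∀ θ ∈ D.Theta D.mu0, ∀ θ' ∈ D.Theta D.mu0, ∀ x y,
      |x ⬝ᵥ ((D.lyapP θ - D.lyapP θ') *ᵥ y)| ≤ C * ‖θ - θ'‖ * (‖x‖ * ‖y‖) := by
  obtain ⟨c, lam, -, h0, h1, h⟩ := hD.exists_Phi_pow_bound
  obtain ⟨b, hb, hP⟩ := hD.exists_lyapP_bound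
  obtain ⟨l, hl, hlip⟩ := exists_Phi_lipschitz (D := D)
  obtain ⟨a, ha, hΦ⟩ := exists_family_bound (exists_Phi_lipschitz (D := D)) hD.Theta0_bounded
  have hlam : 0 < 1 - lam ^ 2 := by nlinarith
  refine ⟨2 * b * l * a * (c ^ 2 * (1 - lam ^ 2)⁻¹), by positivity, fun θ hθ θ' hθ' x y => ?_⟩
  set P := D.lyapP θ
  set P' := D.lyapP θ'
  have hE : (P - P') - (D.Phi θ)ᵀ * (P - P') * D.Phi θ =
      (D.Phi θ)ᵀ * P' * D.Phi θ - (D.Phi θ')ᵀ * P' * D.Phi θ' := by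
    have e1 := hD.lyapP_spec hθ
    have e2 := hD.lyapP_spec hθ'
    rw [mul_sub, sub_mul]
    calc _ = (P - (D.Phi θ)ᵀ * P * D.Phi θ) - (P' - (D.Phi θ')ᵀ * P' * D.Phi θ')
          + ((D.Phi θ)ᵀ * P' * D.Phi θ - (D.Phi θ')ᵀ * P' * D.Phi θ') := by abel
      _ = _ := by rw [e1, e2, sub_self, zero_add]
  have hEb : ∀ x y, |x ⬝ᵥ (((D.Phi θ)ᵀ * P' * D.Phi θ - (D.Phi θ')ᵀ * P' * D.Phi θ') *ᵥ y)| ≤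
      2 * b * l * a * ‖θ - θ'‖ * (‖x‖ * ‖y‖) := by
    intro x y
    have e : x ⬝ᵥ (((D.Phi θ)ᵀ * P' * D.Phi θ - (D.Phi θ')ᵀ * P' * D.Phi θ') *ᵥ y) =
        (D.Phi θ *ᵥ x - D.Phi θ' *ᵥ x) ⬝ᵥ (P' *ᵥ (D.Phi θ *ᵥ y)) +
        (D.Phi θ' *ᵥ x) ⬝ᵥ (P' *ᵥ (D.Phi θ *ᵥ y - D.Phi θ' *ᵥ y)) := by
      rw [sub_mulVec, dotProduct_sub, dotProduct_conj_mulVec, dotProduct_conj_mulVec,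
        sub_dotProduct, mulVec_sub, dotProduct_sub]
      ring
    rw [e]
    calc _ ≤ b * (‖D.Phi θ *ᵥ x - D.Phi θ' *ᵥ x‖ * ‖D.Phi θ *ᵥ y‖) +
          b * (‖D.Phi θ' *ᵥ x‖ * ‖D.Phi θ *ᵥ y - D.Phi θ' *ᵥ y‖) :=
          (abs_add_le _ _).trans (add_le_add (hP θ' hθ' _ _) (hP θ' hθ' _ _))
      _ ≤ b * (l * (‖θ - θ'‖ * ‖x‖) * (a * ‖y‖)) + b * ((a * ‖x‖) * (l * (‖θ - θ'‖ * ‖y‖))) := by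
          have e1 := hlip θ θ' x
          have e2 := hlip θ θ' y
          have e3 := hΦ θ hθ y
          have e4 := hΦ θ' hθ' x
          gcongr
      _ = _ := by ring
  refine (abs_lyapunov_le h0.le h1 (by positivity) (h θ hθ) hEb hE x y).trans (le_of_eq ?_)
  ring

end MPCData

/-! ### Reduction to perturbations and tube, existence of optimizers, recursive feasibility -/

noncomputable section

theorem l2norm_sq {n : ℕ} (a : Fin n → ℝ) : l2norm a ^ 2 = a ⬝ᵥ a := by
  rw [l2norm, EuclideanSpace.norm_sq_eq]
  simp [dotProduct, sq]

theorem Matrix.mulVec_le_mulVec_of_nonneg {k l : ℕ} {L : Matrix (Fin k) (Fin l) ℝ}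
    (hL : ∀ i j, 0 ≤ L i j) {a b : Fin l → ℝ} (h : a ≤ b) : L *ᵥ a ≤ L *ᵥ b := fun i => by
  simp only [mulVec, dotProduct]
  exact Finset.sum_le_sum fun j _ => mul_le_mul_of_nonneg_left (h j) (hL i j)

/-- Finitely many symmetric matrices become positive semidefinite after a common shift. -/
theorem exists_posSemidef_shift {n : ℕ} {ι : Type*} [Finite ι]
    (S : ι → Matrix (Fin n) (Fin n) ℝ) (hS : ∀ i, (S i).IsHermitian) :
    ∃ c : ℝ, ∀ i, (S i + c • (1 : Matrix (Fin n) (Fin n) ℝ)).PosSemidef := by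
  have := Fintype.ofFinite ι
  choose C hC hb using fun i => exists_bilin_bound (S i)
  refine ⟨∑ i, C i, fun i => PosSemidef.of_dotProduct_mulVec_nonneg
    ((hS i).add (by simp [IsHermitian])) fun x => ?_⟩
  have h1 := (abs_le.1 (hb i x x)).1
  have h2 : C i ≤ ∑ i, C i := Finset.single_le_sum (fun i _ => hC i) (Finset.mem_univ i)
  have h3 : ‖x‖ * ‖x‖ ≤ x ⬝ᵥ x := by
    rw [← l2norm_sq, ← sq]
    exact pow_le_pow_left₀ (norm_nonneg _) (norm_le_l2norm x) 2
  simp only [star_trivial, add_mulVec, smul_mulVec, one_mulVec, dotProduct_add, dotProduct_smul,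
    smul_eq_mul]
  have h4 : C i * (‖x‖ * ‖x‖) ≤ (∑ i, C i) * (x ⬝ᵥ x) :=
    mul_le_mul h2 h3 (by positivity) ((hC i).trans h2)
  linarith

namespace MPCData

variable {nx nu p nc nw r na m : ℕ} {D : MPCData nx nu p nc nw r na m}

theorem regD_mulVec_add (θ : Fin p → ℝ) (x : Fin nx → ℝ) (u : Fin nu → ℝ) :
    D.regD x u *ᵥ θ + D.regd x u = D.Ath θ *ᵥ x + D.Bth θ *ᵥ u := by
  have h : D.regD x u *ᵥ θ = ∑ l, θ l • (D.A l *ᵥ x + D.B l *ᵥ u) := by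
    ext i
    simp only [regD, mulVec, dotProduct, of_apply, Finset.sum_apply, Pi.smul_apply, Pi.add_apply,
      smul_eq_mul]
    exact Finset.sum_congr rfl fun l _ => mul_comm _ _
  simp only [h, regd, Ath, Bth, add_mulVec, Matrix.sum_mulVec, smul_mulVec, smul_add,
    Finset.sum_add_distrib]
  abel

theorem TubeStep.mono {μ μ' : Fin r → ℝ} (hμ : μ' ≤ μ) {j : Fin m} {a a' : Fin na → ℝ}
    {v : Fin nu → ℝ} {L : Matrix (Fin na) (Fin r) ℝ} (h : D.TubeStep μ j a v a' L) :
    D.TubeStep μ' j a v a' L :=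
  ⟨h.1, (mulVec_le_mulVec_of_nonneg h.2.2 hμ).trans h.2.1, h.2.2⟩

/-- Row by row, a multiplier exists exactly when a point depending continuously on the data lies in
a fixed finitely generated cone. A projection along the possibly unbounded multipliers would not be
closed for free. -/
theorem isClosed_tubeStep (μ : Fin r → ℝ) (j : Fin m) :
    IsClosed {q : (Fin na → ℝ) × (Fin nu → ℝ) × (Fin na → ℝ) |
      ∃ L, D.TubeStep μ j q.1 q.2.1 q.2.2 L} := by
  -- The generators are the rows of the parameter set with their right-hand sides, and `(0, 1)`,
  -- which absorbs the slack of the inequality.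
  let g : Option (Fin r) → (Fin p → ℝ) × ℝ := fun o => o.elim (0, 1) fun l => (D.Mth l, μ l)
  let z : (Fin na → ℝ) × (Fin nu → ℝ) × (Fin na → ℝ) → (Fin nx → ℝ) := fun q => D.U j *ᵥ q.1
  let u : (Fin na → ℝ) × (Fin nu → ℝ) × (Fin na → ℝ) → (Fin nu → ℝ) :=
    fun q => D.K *ᵥ (D.U j *ᵥ q.1) + q.2.1
  let f : Fin na → (Fin na → ℝ) × (Fin nu → ℝ) × (Fin na → ℝ) → (Fin p → ℝ) × ℝ := fun i q =>
    ((D.T * D.regD (z q) (u q)) i, (q.2.2 - D.T *ᵥ D.regd (z q) (u q) - D.wbar) i)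
  have hz : Continuous z := by fun_prop
  have hu : Continuous u := by fun_prop
  have hf : ∀ i, Continuous (f i) := by
    intro i
    refine Continuous.prodMk ?_ ?_
    · refine continuous_pi fun l => ?_
      simp only [mul_apply, regD, of_apply]
      fun_prop
    · simp only [regd, Pi.sub_apply]
      fun_prop
  have hset : {q : (Fin na → ℝ) × (Fin nu → ℝ) × (Fin na → ℝ) |
      ∃ L, D.TubeStep μ j q.1 q.2.1 q.2.2 L} = ⋂ i, f i ⁻¹' {y | ∃ c : Option (Fin r) → ℝ,
        (∀ o, 0 ≤ c o) ∧ ∑ o ∈ Finset.univ, c o • g o = y} := by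
    ext q
    simp only [mem_ofPred_eq, mem_iInter, mem_preimage]
    constructor
    · rintro ⟨L, h1, h2, h3⟩ i
      refine ⟨fun o => o.elim ((f i q).2 - (L *ᵥ μ) i) (L i), fun o => ?_, ?_⟩
      · cases o with
        | none => exact sub_nonneg.2 (h2 i)
        | some l => exact h3 i l
      · rw [Fintype.sum_option]
        refine Prod.ext ?_ ?_
        · have h1i : (L * D.Mth) i = (f i q).1 := congrFun h1 i
          rw [← h1i]
          ext l
          simp [g, mul_apply, Prod.fst_sum]
        · simp [g, mulVec, dotProduct, Prod.snd_sum]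
    · intro h
      choose c hc hs using h
      refine ⟨of fun i l => c i (some l), ?_, ?_, fun i l => hc i _⟩
      · ext i l
        have := congrFun (congrArg Prod.fst (hs i)) l
        rw [Fintype.sum_option] at this
        simp [g, Prod.fst_sum] at this
        rw [mul_apply]
        exact this
      · intro i
        have := congrArg Prod.snd (hs i)
        rw [Fintype.sum_option] at this
        simp [g, Prod.snd_sum] at this
        have h0 := hc i none
        have e : ((of fun i l => c i (some l)) *ᵥ μ) i = ∑ l, c i (some l) * μ l := rfl
        rw [e]
        change _ ≤ (f i q).2
        linarith
  rw [hset]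
  exact isClosed_iInter fun i => (isClosed_finset_cone g _).preimage (hf i)

variable (D) in
/-- The constraints on the perturbations and the tube, with multipliers eliminated and the
conditions repeated beyond the horizon. -/
structure TubeFeasible (μ : Fin r → ℝ) (x : Fin nx → ℝ) (v : ℕ → Fin nu → ℝ)
    (α : ℕ → Fin na → ℝ) : Prop where
  v_tail : ∀ k, D.N ≤ k → v k = 0
  α_tail : ∀ k, D.N ≤ k → α k = α D.N
  initial : D.T *ᵥ x ≤ α 0
  state_input : ∀ k j, (D.F + D.G * D.K) *ᵥ (D.U j *ᵥ α k) + D.G *ᵥ v k ≤ 1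
  tube : ∀ k j, ∃ L, D.TubeStep μ j (α k) (v k) (α (k + 1)) L

theorem Feasible.tubeFeasible {x : Fin nx → ℝ} {μ : Fin r → ℝ} {θb : Fin p → ℝ}
    {xh : ℕ → Fin nx → ℝ} {uh : ℕ → Fin nu → ℝ} {d : MPCDecision nx nu p r na m}
    (h : D.Feasible x μ θb xh uh d) : D.TubeFeasible μ x d.v d.α where
  v_tail := h.v_tail
  α_tail := h.α_tail
  initial := h.initial
  state_input k j := by
    rcases lt_or_ge k D.N with hk | hk
    · exact h.state_input k hk j
    · rw [h.v_tail k hk, h.α_tail k hk, mulVec_zero, add_zero]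
      exact h.term_state_input j
  tube k j := by
    rcases lt_or_ge k D.N with hk | hk
    · exact ⟨_, h.tube k hk j⟩
    · rw [h.v_tail k hk, h.α_tail k hk, h.α_tail (k + 1) (by omega)]
      exact ⟨_, h.term_tube j⟩

variable (D) in
/-- Nominal predictions. -/
def traj (θ : Fin p → ℝ) (x : Fin nx → ℝ) (v : ℕ → Fin nu → ℝ) : ℕ → Fin nx → ℝ
  | 0 => x
  | k + 1 => D.Phi θ *ᵥ traj θ x v k + D.Bth θ *ᵥ v k

variable (D) in
/-- The objective without excitation term as a function of the perturbations. -/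
def cost (θ : Fin p → ℝ) (x : Fin nx → ℝ) (v : ℕ → Fin nu → ℝ) : ℝ :=
  (∑ k ∈ Finset.range D.N,
    (wsq D.Q (D.traj θ x v k) + wsq D.R (D.K *ᵥ D.traj θ x v k + v k)))
    + wsq (D.lyapP θ) (D.traj θ x v D.N)

theorem Feasible.xbar_eq {x : Fin nx → ℝ} {μ : Fin r → ℝ} {θb : Fin p → ℝ}
    {xh : ℕ → Fin nx → ℝ} {uh : ℕ → Fin nu → ℝ} {d : MPCDecision nx nu p r na m}
    (h : D.Feasible x μ θb xh uh d) (k : ℕ) : d.xbar k = D.traj θb x d.v k := by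
  induction k with
  | zero => exact h.nom_init
  | succ k ih => rw [h.nom_state, ih, traj]

theorem Feasible.objective_eq (hgam : D.gam = 0) {x : Fin nx → ℝ} {μ : Fin r → ℝ}
    {θb : Fin p → ℝ} {xh : ℕ → Fin nx → ℝ} {uh : ℕ → Fin nu → ℝ}
    {d : MPCDecision nx nu p r na m} (h : D.Feasible x μ θb xh uh d) :
    D.objective θb d = D.cost θb x d.v := by
  simp only [objective, cost, h.nom_input, h.xbar_eq, hgam, zero_mul, sub_zero]

theorem isHermitian_peLin (xh x : Fin nx → ℝ) (uh u : Fin nu → ℝ) :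
    (D.peLin xh uh x u).IsHermitian := by
  simp only [peLin, IsHermitian, conjTranspose_eq_transpose_of_trivial, transpose_add,
    transpose_mul, transpose_transpose]
  abel

/-- The excitation conditions, and the multipliers, can always be met. -/
theorem TubeFeasible.exists_feasible {x : Fin nx → ℝ} {μ : Fin r → ℝ} {v : ℕ → Fin nu → ℝ}
    {α : ℕ → Fin na → ℝ} (h : D.TubeFeasible μ x v α) (θb : Fin p → ℝ) (xh : ℕ → Fin nx → ℝ)
    (uh : ℕ → Fin nu → ℝ) :
    ∃ d : MPCDecision nx nu p r na m, D.Feasible x μ θb xh uh d ∧ d.v = v := by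
  choose L hL using h.tube
  choose c hc using fun k => exists_posSemidef_shift
    (fun j => D.peLin (xh k) (uh k) (D.U j *ᵥ α k) (D.K *ᵥ (D.U j *ᵥ α k) + v k))
    fun j => isHermitian_peLin _ _ _ _
  -- The choice `M_k = -c_k I` with the matching `β` turns the summed condition into `0 ⪰ 0`.
  refine ⟨⟨v, α, D.traj θb x v, fun k => D.K *ᵥ D.traj θb x v k + v k,
    ∑ k ∈ Finset.range D.Nu, -c k, fun k => (-c k) • 1, L⟩, ?_, rfl⟩
  exact
    { v_tail := h.v_tail
      α_tail := h.α_tail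
      initial := h.initial
      state_input := fun k _ j => h.state_input k j
      tube := fun k _ j => hL k j
      term_state_input := fun j => by
        have := h.state_input D.N j
        rwa [h.v_tail _ le_rfl, mulVec_zero, add_zero] at this
      term_tube := fun j => by
        have := hL D.N j
        rwa [h.v_tail _ le_rfl, h.α_tail (D.N + 1) (by omega)] at this
      nom_init := rfl
      nom_state := fun k => rfl
      nom_input := fun k => rfl
      pe_step := fun k _ j => by simpa [sub_neg_eq_add] using hc k j
      pe_sum := by
        rw [← Finset.sum_smul, sub_self]
        exact PosSemidef.zero }

/-- With the excitation weight equal to zero, the cost sees only `v`, and every tube-feasible pair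
extends to a full decision. -/
theorem isSolution_iff (hgam : D.gam = 0) {x : Fin nx → ℝ} {μ : Fin r → ℝ} {θb : Fin p → ℝ}
    {xh : ℕ → Fin nx → ℝ} {uh : ℕ → Fin nu → ℝ} {d : MPCDecision nx nu p r na m}
    (hd : D.Feasible x μ θb xh uh d) :
    D.IsSolution x μ θb xh uh d ↔
      ∀ v α, D.TubeFeasible μ x v α → D.cost θb x d.v ≤ D.cost θb x v := by
  constructor
  · intro h v α hv
    obtain ⟨d', hd', rfl⟩ := hv.exists_feasible θb xh uh
    rw [← hd.objective_eq hgam, ← hd'.objective_eq hgam]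
    exact h.2 d' hd'
  · intro h
    refine ⟨hd, fun d' hd' => ?_⟩
    rw [hd.objective_eq hgam, hd'.objective_eq hgam]
    exact h _ _ hd'.tubeFeasible

theorem isClosed_tubeFeasible (μ : Fin r → ℝ) (x : Fin nx → ℝ) :
    IsClosed {q : (ℕ → Fin nu → ℝ) × (ℕ → Fin na → ℝ) | D.TubeFeasible μ x q.1 q.2} := by
  have hset : {q : (ℕ → Fin nu → ℝ) × (ℕ → Fin na → ℝ) | D.TubeFeasible μ x q.1 q.2} =
      {q | ∀ k, D.N ≤ k → q.1 k = 0} ∩ {q | ∀ k, D.N ≤ k → q.2 k = q.2 D.N} ∩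
      {q | D.T *ᵥ x ≤ q.2 0} ∩
      {q | ∀ k j, (D.F + D.G * D.K) *ᵥ (D.U j *ᵥ q.2 k) + D.G *ᵥ q.1 k ≤ 1} ∩
      {q | ∀ k j, (q.2 k, q.1 k, q.2 (k + 1)) ∈ {q : (Fin na → ℝ) × (Fin nu → ℝ) × (Fin na → ℝ) |
        ∃ L, D.TubeStep μ j q.1 q.2.1 q.2.2 L}} := by
    ext q
    exact ⟨fun h => ⟨⟨⟨⟨h.1, h.2⟩, h.3⟩, h.4⟩, h.5⟩, fun h => ⟨h.1.1.1.1, h.1.1.1.2, h.1.1.2,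
      h.1.2, h.2⟩⟩
  rw [hset]
  refine IsClosed.inter (IsClosed.inter (IsClosed.inter (IsClosed.inter ?_ ?_) ?_) ?_) ?_
  · simp only [ofPred_forall]
    exact isClosed_iInter fun k => isClosed_iInter fun _ =>
      isClosed_eq (by fun_prop) (by fun_prop)
  · simp only [ofPred_forall]
    exact isClosed_iInter fun k => isClosed_iInter fun _ =>
      isClosed_eq (by fun_prop) (by fun_prop)
  · exact isClosed_le (by fun_prop) (by fun_prop)
  · simp only [ofPred_forall]
    exact isClosed_iInter fun k => isClosed_iInter fun j =>
      isClosed_le (by fun_prop) (by fun_prop)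
  · simp only [ofPred_forall]
    exact isClosed_iInter fun k => isClosed_iInter fun j =>
      (isClosed_tubeStep μ j).preimage (by fun_prop)

theorem Assumptions.exists_feasible_bound (hD : D.Assumptions) : ∃ ρ, 0 ≤ ρ ∧
    ∀ μ x v α, D.TubeFeasible μ x v α → ∀ k, ‖v k‖ ≤ ρ ∧ ‖α k‖ ≤ ρ := by
  obtain ⟨ρ, hρ0, hρ⟩ := hD.Z_compact.isBounded.exists_pos_norm_le
  obtain ⟨C, hC, hα⟩ := hD.exists_tube_bound
  obtain ⟨b, hb, hK⟩ := exists_mulVec_bound D.K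
  obtain ⟨j₀⟩ := hD.nonempty_vertices
  refine ⟨max (ρ + b * ρ) (C * ρ), by positivity, fun μ x v α h k => ?_⟩
  have hZ : ∀ j, (D.U j *ᵥ α k, D.K *ᵥ (D.U j *ᵥ α k) + v k) ∈ D.Z := fun j => by
    have := h.state_input k j
    rw [add_mulVec, ← mulVec_mulVec, add_assoc, ← mulVec_add] at this
    exact this
  have h1 : ∀ j, ‖D.U j *ᵥ α k‖ ≤ ρ := fun j => (norm_fst_le _).trans (hρ _ (hZ j))
  refine ⟨le_max_of_le_left ?_, le_max_of_le_right (hα _ _ hρ0.le h1)⟩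
  have h2 := (norm_snd_le _).trans (hρ _ (hZ j₀))
  have h3 := (hK (D.U j₀ *ᵥ α k)).trans (mul_le_mul_of_nonneg_left (h1 j₀) hb)
  calc ‖v k‖ = ‖(D.K *ᵥ (D.U j₀ *ᵥ α k) + v k) - D.K *ᵥ (D.U j₀ *ᵥ α k)‖ := by
        rw [add_sub_cancel_left]
    _ ≤ _ := (norm_sub_le _ _).trans (add_le_add h2 h3)

theorem continuous_cost (θ : Fin p → ℝ) (x : Fin nx → ℝ) : Continuous (D.cost θ x) := by
  have h : ∀ k, Continuous fun v => D.traj θ x v k := by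
    intro k
    induction k with
    | zero => exact continuous_const
    | succ k ih =>
      simp only [traj]
      fun_prop
  unfold cost
  refine Continuous.add (continuous_finsetSum _ fun k _ => ?_) ((continuous_wsq _).comp (h _))
  have := h k
  exact ((continuous_wsq _).comp this).add ((continuous_wsq _).comp (by fun_prop))

/-- A feasible problem has an optimal solution. -/
theorem TubeFeasible.exists_isSolution (hD : D.Assumptions) (hgam : D.gam = 0)
    {x : Fin nx → ℝ} {μ : Fin r → ℝ} {v : ℕ → Fin nu → ℝ} {α : ℕ → Fin na → ℝ}
    (h : D.TubeFeasible μ x v α) (θb : Fin p → ℝ) (xh : ℕ → Fin nx → ℝ)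
    (uh : ℕ → Fin nu → ℝ) : ∃ d, D.IsSolution x μ θb xh uh d := by
  obtain ⟨ρ, -, hρ⟩ := hD.exists_feasible_bound
  have hcpt : IsCompact {q : (ℕ → Fin nu → ℝ) × (ℕ → Fin na → ℝ) |
      D.TubeFeasible μ x q.1 q.2} := by
    -- Sequences indexed by all of `ℕ` are compact by Tychonoff once every term is bounded.
    refine IsCompact.of_isClosed_subset
      ((isCompact_univ_pi fun _ : ℕ => isCompact_closedBall (0 : Fin nu → ℝ) ρ).prod
        (isCompact_univ_pi fun _ : ℕ => isCompact_closedBall (0 : Fin na → ℝ) ρ))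
      (isClosed_tubeFeasible μ x) fun q hq => ?_
    exact ⟨fun k _ => by simpa using (hρ _ _ _ _ hq k).1,
      fun k _ => by simpa using (hρ _ _ _ _ hq k).2⟩
  obtain ⟨q, hq, hmin⟩ := hcpt.exists_isMinOn ⟨(v, α), h⟩
    (f := fun q => D.cost θb x q.1) ((continuous_cost θb x).comp continuous_fst).continuousOn
  obtain ⟨d, hd, hdv⟩ := hq.exists_feasible θb xh uh
  refine ⟨d, (isSolution_iff hgam hd).2 fun v' α' h' => ?_⟩
  rw [hdv]
  exact isMinOn_iff.1 hmin (v', α') h'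

theorem TubeFeasible.mem_Z (hD : D.Assumptions) {x : Fin nx → ℝ} {μ : Fin r → ℝ}
    {v : ℕ → Fin nu → ℝ} {α : ℕ → Fin na → ℝ} (h : D.TubeFeasible μ x v α) :
    (x, D.K *ᵥ x + v 0) ∈ D.Z := by
  have := hD.mulVec_le_of_vertices (D.F + D.G * D.K) (1 - D.G *ᵥ v 0)
    (fun j => le_sub_iff_add_le.2 (h.state_input 0 j)) h.initial
  rw [le_sub_iff_add_le, add_mulVec, ← mulVec_mulVec, add_assoc, ← mulVec_add] at this
  exact this

theorem Assumptions.T_le_wbar (hD : D.Assumptions) {w : Fin nx → ℝ} (hw : w ∈ D.W) :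
    D.T *ᵥ w ≤ D.wbar := fun i =>
  le_csSup (hD.W_compact.image (f := fun w => (D.T *ᵥ w) i) (by fun_prop)).bddAbove
    (mem_image_of_mem _ hw)

/-- The tube contains all successor states. -/
theorem Assumptions.tube_succ (hD : D.Assumptions) {μ : Fin r → ℝ} {θ : Fin p → ℝ}
    (hθ : θ ∈ D.Theta μ) {w : Fin nx → ℝ} (hw : w ∈ D.W) {a a' : Fin na → ℝ}
    {v : Fin nu → ℝ} (h : ∀ j, ∃ L, D.TubeStep μ j a v a' L) {x : Fin nx → ℝ}
    (hx : x ∈ D.X a) : D.Phi θ *ᵥ x + D.Bth θ *ᵥ v + w ∈ D.X a' := by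
  have := hD.mulVec_le_of_vertices (D.T * D.Phi θ) (a' - D.T *ᵥ (D.Bth θ *ᵥ v) - D.T *ᵥ w)
    (fun j => by
      obtain ⟨L, h1, h2, h3⟩ := h j
      have e : D.Phi θ *ᵥ (D.U j *ᵥ a) + D.Bth θ *ᵥ v =
          D.regD (D.U j *ᵥ a) (D.K *ᵥ (D.U j *ᵥ a) + v) *ᵥ θ +
          D.regd (D.U j *ᵥ a) (D.K *ᵥ (D.U j *ᵥ a) + v) := by
        rw [regD_mulVec_add, Phi_mulVec, mulVec_add, add_assoc]
      -- Weak duality: a nonnegative multiplier turns `M_Θ θ ≤ μ` into a bound on the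
      -- parameter-dependent part of the successor.
      have h4 : (L * D.Mth) *ᵥ θ ≤ L *ᵥ μ := by
        rw [← mulVec_mulVec]
        exact mulVec_le_mulVec_of_nonneg h3 hθ
      rw [h1, ← mulVec_mulVec] at h4
      have h5 := hD.T_le_wbar hw
      have e' := congrArg (D.T *ᵥ ·) e
      simp only [mulVec_add] at e'
      intro i
      have h2i := h2 i
      have h4i := h4 i
      have h5i := h5 i
      have ei := congrFun e' i
      rw [← mulVec_mulVec]
      simp only [Pi.sub_apply, Pi.add_apply] at *
      linarith) hx
  intro i
  have hi := this i
  rw [← mulVec_mulVec] at hi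
  simp only [mulVec_add, Pi.sub_apply, Pi.add_apply] at *
  linarith

/-- Feasibility of the shifted solution at the successor state. -/
theorem TubeFeasible.shift (hD : D.Assumptions) {x : Fin nx → ℝ} {μ μ' : Fin r → ℝ}
    {v : ℕ → Fin nu → ℝ} {α : ℕ → Fin na → ℝ} (h : D.TubeFeasible μ x v α) (hμ : μ' ≤ μ)
    {θ : Fin p → ℝ} (hθ : θ ∈ D.Theta μ) {w : Fin nx → ℝ} (hw : w ∈ D.W) :
    D.TubeFeasible μ' (D.Ath θ *ᵥ x + D.Bth θ *ᵥ (D.K *ᵥ x + v 0) + w)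
      (fun k => v (k + 1)) (fun k => α (k + 1)) where
  v_tail k hk := h.v_tail _ (by omega)
  α_tail k hk := by
    rw [h.α_tail (k + 1) (by omega), h.α_tail (D.N + 1) (by omega)]
  initial := by
    have := hD.tube_succ hθ hw (h.tube 0) h.initial
    rwa [Phi_mulVec, add_assoc (D.Ath θ *ᵥ x), ← mulVec_add] at this
  state_input k j := h.state_input _ _
  tube k j := (h.tube (k + 1) j).imp fun _ hL => hL.mono hμ

end MPCData

end

/-! ### Closed-loop runs: invariants, one-step extension, infinite runs -/

namespace MPCData

variable {nx nu p nc nw r na m : ℕ} {D : MPCData nx nu p nc nw r na m}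
  {θs : Fin p → ℝ} {w : ℕ → Fin nx → ℝ} {τ τ' : MPCSignals nx nu p r na m}

theorem StepOK.mu_le {s : ℕ} (h : D.StepOK θs w τ s) : τ.mu (s + 1) ≤ τ.mu s :=
  h.mu.2 fun _ hθ => hθ.1

theorem mem_Delta_of_plant {x : Fin nx → ℝ} {u : Fin nu → ℝ} {w : Fin nx → ℝ} (hw : w ∈ D.W) :
    θs ∈ D.Delta (D.Ath θs *ᵥ x + D.Bth θs *ᵥ u + w) x u := by
  have e : D.Ath θs *ᵥ x + D.Bth θs *ᵥ u + w - D.Ath θs *ᵥ x - D.Bth θs *ᵥ u = w := by abel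
  rw [Delta, mem_ofPred_eq, e]
  exact hw

theorem mem_consistentSet (hw : ∀ t, w t ∈ D.W) {s : ℕ} (hθ : θs ∈ D.Theta (τ.mu s))
    (h : ∀ i ≤ s, τ.x (i + 1) = D.Ath θs *ᵥ τ.x i + D.Bth θs *ᵥ τ.u i + w i) :
    θs ∈ D.consistentSet τ s := by
  refine ⟨hθ, fun i hi _ => ?_⟩
  rw [h i (by omega)]
  exact mem_Delta_of_plant (hw i)

/-- Recursive feasibility, together with the set membership of the true and nominal parameters. -/
theorem RunTo.invariant (hD : D.Assumptions) (hθ : θs ∈ D.Theta D.mu0) (hw : ∀ t, w t ∈ D.W)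
    {t : ℕ} (h0 : τ.x 0 ∈ D.XP) (h : D.RunTo θs w τ t) :
    τ.mu t ≤ D.mu0 ∧ θs ∈ D.Theta (τ.mu t) ∧ τ.thbar t ∈ D.Theta (τ.mu t) ∧
      ∃ v α, D.TubeFeasible (τ.mu t) (τ.x t) v α := by
  induction t with
  | zero =>
    obtain ⟨d, hd⟩ := h0
    rw [h.1.mu, h.1.thbar]
    exact ⟨le_rfl, hθ, hD.thbar0_mem, _, _, hd.tubeFeasible⟩
  | succ t ih =>
    obtain ⟨i1, i2, -, -⟩ := ih ⟨h.1, fun s hs => h.2 s (by omega)⟩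
    have hs := h.2 t (by omega)
    have hc := mem_consistentSet hw i2 fun i hi => (h.2 i (by omega)).plant
    refine ⟨hs.mu_le.trans i1, hs.mu.1 hc, hs.thbar_mem, fun k => (τ.dec t).v (k + 1),
      fun k => (τ.dec t).α (k + 1), ?_⟩
    rw [hs.plant, hs.input]
    exact hs.solve.1.tubeFeasible.shift hD hs.mu_le i2 (hw t)

theorem isClosed_Theta (μ : Fin r → ℝ) : IsClosed (D.Theta μ) :=
  isClosed_le (by fun_prop) continuous_const

theorem Theta_mono {μ μ' : Fin r → ℝ} (h : μ ≤ μ') : D.Theta μ ⊆ D.Theta μ' :=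
  fun _ hθ => le_trans hθ h

theorem Assumptions.isCompact_Theta (hD : D.Assumptions) {μ : Fin r → ℝ} (hμ : μ ≤ D.mu0) :
    IsCompact (D.Theta μ) :=
  Metric.isCompact_of_isClosed_isBounded (isClosed_Theta μ)
    (hD.Theta0_bounded.subset (Theta_mono hμ))

/-- The least right-hand side of a parameter set that contains a given set. -/
theorem exists_isLeast_Theta {C : Set (Fin p → ℝ)} (hC : C.Nonempty) {μ : Fin r → ℝ}
    (hμ : C ⊆ D.Theta μ) : ∃ μ', IsLeast {μ | C ⊆ D.Theta μ} μ' := by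
  refine ⟨fun i => sSup ((fun θ => (D.Mth *ᵥ θ) i) '' C), fun θ hθ i => ?_, fun ν hν i => ?_⟩
  · refine le_csSup ⟨μ i, ?_⟩ (mem_image_of_mem _ hθ)
    rintro _ ⟨θ', hθ', rfl⟩
    exact hμ hθ' i
  · refine csSup_le (hC.image _) ?_
    rintro _ ⟨θ', hθ', rfl⟩
    exact hν hθ' i

/-- Two families of signals agree up to time `t`. -/
structure Agree (t : ℕ) (τ τ' : MPCSignals nx nu p r na m) : Prop where
  x : ∀ k ≤ t, τ'.x k = τ.x k
  mu : ∀ k ≤ t, τ'.mu k = τ.mu k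
  thbar : ∀ k ≤ t, τ'.thbar k = τ.thbar k
  xhat : ∀ k ≤ t, τ'.xhat k = τ.xhat k
  uhat : ∀ k ≤ t, τ'.uhat k = τ.uhat k
  u : ∀ k < t, τ'.u k = τ.u k
  dec : ∀ k < t, τ'.dec k = τ.dec k

theorem Agree.refl (t : ℕ) (τ : MPCSignals nx nu p r na m) : Agree t τ τ := by
  constructor <;> exact fun _ _ => rfl

theorem Agree.trans {s t : ℕ} (hst : s ≤ t) {τ τ' τ'' : MPCSignals nx nu p r na m}
    (h : Agree s τ τ') (h' : Agree t τ' τ'') : Agree s τ τ'' where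
  x k hk := (h'.x k (hk.trans hst)).trans (h.x k hk)
  mu k hk := (h'.mu k (hk.trans hst)).trans (h.mu k hk)
  thbar k hk := (h'.thbar k (hk.trans hst)).trans (h.thbar k hk)
  xhat k hk := (h'.xhat k (hk.trans hst)).trans (h.xhat k hk)
  uhat k hk := (h'.uhat k (hk.trans hst)).trans (h.uhat k hk)
  u k hk := (h'.u k (hk.trans_le hst)).trans (h.u k hk)
  dec k hk := (h'.dec k (hk.trans_le hst)).trans (h.dec k hk)

theorem Agree.mono {s t : ℕ} (hst : s ≤ t) (h : Agree t τ τ') : Agree s τ τ' :=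
  (Agree.refl s τ).trans hst h

/-- The step from `s` to `s + 1` reads inputs and decisions only up to time `s`, and all other
signals only up to `s + 1`; this is why `Agree` uses strict bounds for `u` and `dec`. -/
theorem StepOK.congr {s : ℕ} (h : D.StepOK θs w τ s) (ha : Agree (s + 1) τ τ') :
    D.StepOK θs w τ' s := by
  have hc : D.consistentSet τ' s = D.consistentSet τ s := by
    ext θ
    simp only [consistentSet, mem_ofPred_eq, ha.mu s (by omega)]
    refine and_congr_right fun _ => forall_congr' fun i => forall_congr' fun hi => ?_
    rw [ha.x (i + 1) (by omega), ha.x i (by omega), ha.u i hi]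
  obtain ⟨h1, h2, h3, h4, h5, h6, h7, h8, h9⟩ := h
  rw [← ha.x s (by omega), ← ha.mu s (by omega), ← ha.thbar s (by omega),
    ← ha.xhat s (by omega), ← ha.uhat s (by omega), ← ha.dec s (by omega)] at h1
  rw [← ha.u s (by omega), ← ha.x s (by omega), ← ha.dec s (by omega)] at h2
  rw [← ha.u s (by omega), ← ha.x s (by omega), ← ha.x (s + 1) le_rfl] at h3
  rw [← ha.mu (s + 1) le_rfl, ← hc] at h4
  rw [← ha.mu (s + 1) le_rfl, ← ha.thbar (s + 1) le_rfl] at h5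
  rw [← ha.mu (s + 1) le_rfl, ← ha.thbar (s + 1) le_rfl, ← ha.thbar s (by omega)] at h6
  rw [← ha.xhat (s + 1) le_rfl, ← ha.x (s + 1) le_rfl] at h7
  rw [← ha.xhat (s + 1) le_rfl, ← ha.uhat (s + 1) le_rfl, ← ha.thbar (s + 1) le_rfl] at h8
  rw [← ha.xhat (s + 1) le_rfl, ← ha.uhat (s + 1) le_rfl, ← ha.dec s (by omega)] at h9
  exact ⟨h1, h2, h3, h4, h5, h6, h7, h8, h9⟩

theorem InitOK.congr {t : ℕ} (h : D.InitOK τ) (ha : Agree t τ τ') : D.InitOK τ' where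
  mu := (ha.mu 0 (by omega)).trans h.mu
  thbar := (ha.thbar 0 (by omega)).trans h.thbar
  xhat := by rw [ha.xhat 0 (by omega), ha.x 0 (by omega), h.xhat]
  uhat := by rw [ha.uhat 0 (by omega), ha.x 0 (by omega), h.uhat]

theorem RunTo.congr {t : ℕ} (h : D.RunTo θs w τ t) (ha : Agree t τ τ') : D.RunTo θs w τ' t :=
  ⟨h.1.congr ha, fun s hs => (h.2 s hs).congr (ha.mono hs)⟩

variable (D) in
/-- Reference states generated by the feedback law with given perturbations. -/
def refState (θ : Fin p → ℝ) (x : Fin nx → ℝ) (v : ℕ → Fin nu → ℝ) : ℕ → Fin nx → ℝ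
  | 0 => x
  | k + 1 => D.Ath θ *ᵥ refState θ x v k + D.Bth θ *ᵥ (D.K *ᵥ refState θ x v k + v k)

/-- A closed loop run can be continued by one step. -/
theorem RunTo.exists_succ (hD : D.Assumptions) (hgam : D.gam = 0) (hθ : θs ∈ D.Theta D.mu0)
    (hw : ∀ t, w t ∈ D.W) {t : ℕ} (h0 : τ.x 0 ∈ D.XP) (h : D.RunTo θs w τ t) :
    ∃ τ', D.RunTo θs w τ' (t + 1) ∧ Agree t τ τ' := by
  obtain ⟨i1, i2, i3, v, α, hv⟩ := h.invariant hD hθ hw h0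
  obtain ⟨d, hd⟩ := hv.exists_isSolution hD hgam (τ.thbar t) (τ.xhat t) (τ.uhat t)
  let u := D.K *ᵥ τ.x t + d.v 0
  let x := D.Ath θs *ᵥ τ.x t + D.Bth θs *ᵥ u + w t
  -- The new consistent set depends on the new input and state, so these are entered before the
  -- parameter set is chosen.
  let τ₁ : MPCSignals nx nu p r na m :=
    ⟨Function.update τ.x (t + 1) x, Function.update τ.u t u, τ.mu, τ.thbar, τ.xhat, τ.uhat, τ.dec⟩
  have hc : θs ∈ D.consistentSet τ₁ t := by
    refine mem_consistentSet (τ := τ₁) hw i2 fun i hi => ?_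
    rcases hi.lt_or_eq with hi | rfl
    · have := (h.2 i hi).plant
      simp only [τ₁]
      rwa [Function.update_of_ne (by omega), Function.update_of_ne (by omega),
        Function.update_of_ne (by omega)]
    · simp only [τ₁]
      rw [Function.update_self, Function.update_self, Function.update_of_ne (by omega)]
  -- The true parameter is consistent, which gives the nonemptiness needed for the least right-hand
  -- side and for the projection.
  obtain ⟨μ, hμ⟩ := exists_isLeast_Theta (D := D) ⟨θs, hc⟩ (μ := τ.mu t) fun θ hθ => hθ.1
  have hμle : μ ≤ τ.mu t := hμ.2 fun θ hθ => hθ.1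
  obtain ⟨θb, hθb, hmin⟩ := (hD.isCompact_Theta (hμle.trans i1)).exists_isMinOn ⟨θs, hμ.1 hc⟩
    (f := fun θ => l2norm (τ.thbar t - θ))
    (continuous_l2norm.comp (by fun_prop)).continuousOn
  let xh := D.refState θb x fun k => d.v (k + 1)
  let τ' : MPCSignals nx nu p r na m :=
    ⟨τ₁.x, τ₁.u, Function.update τ.mu (t + 1) μ, Function.update τ.thbar (t + 1) θb,
      Function.update τ.xhat (t + 1) xh,
      Function.update τ.uhat (t + 1) (fun k => D.K *ᵥ xh k + d.v (k + 1)),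
      Function.update τ.dec t d⟩
  have hne : ∀ k ≤ t, k ≠ t + 1 := fun k hk => by omega
  have ha : Agree t τ τ' :=
    { x := fun k hk => Function.update_of_ne (hne k hk) _ _
      mu := fun k hk => Function.update_of_ne (hne k hk) _ _
      thbar := fun k hk => Function.update_of_ne (hne k hk) _ _
      xhat := fun k hk => Function.update_of_ne (hne k hk) _ _
      uhat := fun k hk => Function.update_of_ne (hne k hk) _ _
      u := fun k hk => Function.update_of_ne hk.ne _ _
      dec := fun k hk => Function.update_of_ne hk.ne _ _ }
  have hx : τ'.x (t + 1) = x := Function.update_self ..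
  have hu : τ'.u t = u := Function.update_self ..
  have hmu : τ'.mu (t + 1) = μ := Function.update_self ..
  have hthb : τ'.thbar (t + 1) = θb := Function.update_self ..
  have hxh : τ'.xhat (t + 1) = xh := Function.update_self ..
  have huh : τ'.uhat (t + 1) = fun k => D.K *ᵥ xh k + d.v (k + 1) := Function.update_self ..
  have hdec : τ'.dec t = d := Function.update_self ..
  refine ⟨τ', ⟨h.1.congr ha, fun s hs => ?_⟩, ha⟩
  rcases (Nat.lt_succ_iff.1 hs).lt_or_eq with hs | rfl
  · exact (h.2 s hs).congr (ha.mono hs)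
  · exact
      { solve := by
          rw [ha.x s le_rfl, ha.mu s le_rfl, ha.thbar s le_rfl, ha.xhat s le_rfl,
            ha.uhat s le_rfl, hdec]
          exact hd
        input := by rw [hu, ha.x s le_rfl, hdec]
        plant := by rw [hx, ha.x s le_rfl, hu]
        mu := by
          have e : D.consistentSet τ' s = D.consistentSet τ₁ s := by
            simp only [consistentSet, ha.mu s le_rfl]
            rfl
          rw [hmu, e]
          exact hμ
        thbar_mem := by
          rw [hmu, hthb]
          exact hθb
        thbar_min := fun θ hθ => by
          rw [hmu] at hθ
          rw [hthb, ha.thbar s le_rfl]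
          exact isMinOn_iff.1 hmin θ hθ
        xhat_zero := by
          rw [hxh, hx]
          rfl
        xhat_succ := fun k => by
          rw [hxh, hthb, huh]
          rfl
        uhat := fun k => by rw [huh, hxh, hdec] }

/-- Closed loop runs of infinite length exist. -/
theorem Assumptions.exists_run (hD : D.Assumptions) (hgam : D.gam = 0)
    (hθ : θs ∈ D.Theta D.mu0) (hw : ∀ t, w t ∈ D.W) {x₀ : Fin nx → ℝ} (hx₀ : x₀ ∈ D.XP) :
    ∃ τ, τ.x 0 = x₀ ∧ ∀ t, D.RunTo θs w τ t := by
  have hx₀' := hx₀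
  obtain ⟨d₀, -⟩ := hx₀'
  have hext : ∀ t (τ : {τ // τ.x 0 = x₀ ∧ D.RunTo θs w τ t}),
      ∃ τ' : {τ // τ.x 0 = x₀ ∧ D.RunTo θs w τ (t + 1)}, Agree t τ.1 τ'.1 := by
    rintro t ⟨τ, hτ0, hτ⟩
    obtain ⟨τ', h1, h2⟩ := hτ.exists_succ hD hgam hθ hw (hτ0 ▸ hx₀)
    exact ⟨⟨τ', (h2.x 0 (by omega)).trans hτ0, h1⟩, h2⟩
  choose next hnext using hext
  let τ₀ : {τ // τ.x 0 = x₀ ∧ D.RunTo θs w τ 0} :=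
    ⟨⟨fun _ => x₀, fun _ => 0, fun _ => D.mu0, fun _ => D.thbar0, fun _ => D.refx0 x₀,
      fun _ => D.refu0 x₀, fun _ => d₀⟩, rfl, ⟨rfl, rfl, rfl, rfl⟩, fun s hs => by omega⟩
  let f : ∀ t, {τ // τ.x 0 = x₀ ∧ D.RunTo θs w τ t} := fun t => Nat.rec τ₀ next t
  have hf : ∀ s k, Agree s (f s).1 (f (s + k)).1 := by
    intro s k
    induction k with
    | zero => exact Agree.refl _ _
    | succ k ih => exact ih.trans (by omega) (hnext (s + k) (f (s + k)))
  have hf' : ∀ s t, s ≤ t → Agree s (f s).1 (f t).1 := fun s t hst => by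
    obtain ⟨k, rfl⟩ := Nat.exists_eq_add_of_le hst
    exact hf s k
  -- Diagonal of the finite runs; the input and decision of time `t` are fixed only by the run of
  -- length `t + 1`.
  let τ : MPCSignals nx nu p r na m :=
    ⟨fun t => (f t).1.x t, fun t => (f (t + 1)).1.u t, fun t => (f t).1.mu t,
      fun t => (f t).1.thbar t, fun t => (f t).1.xhat t, fun t => (f t).1.uhat t,
      fun t => (f (t + 1)).1.dec t⟩
  have ha : ∀ t, Agree t (f t).1 τ := fun t =>
    { x := fun k hk => ((hf' k t hk).x k le_rfl).symm
      mu := fun k hk => ((hf' k t hk).mu k le_rfl).symm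
      thbar := fun k hk => ((hf' k t hk).thbar k le_rfl).symm
      xhat := fun k hk => ((hf' k t hk).xhat k le_rfl).symm
      uhat := fun k hk => ((hf' k t hk).uhat k le_rfl).symm
      u := fun k hk => ((hf' (k + 1) t hk).u k (by omega)).symm
      dec := fun k hk => ((hf' (k + 1) t hk).dec k (by omega)).symm }
  exact ⟨τ, (f 0).2.1, fun t => (f t).2.2.congr (ha t)⟩

theorem Assumptions.wellPosed (hD : D.Assumptions) (hgam : D.gam = 0) : D.WellPosed D.XP :=
  fun _ hθ _ hw => ⟨fun _ hx => hD.exists_run hgam hθ hw hx, fun τ t h0 h => by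
    obtain ⟨-, -, -, v, α, hv⟩ := h.invariant hD hθ hw h0
    exact hv.exists_isSolution hD hgam _ _ _⟩

theorem Assumptions.robustConstraints (hD : D.Assumptions) : D.RobustConstraints D.XP :=
  fun _ _ _ _ τ t _ h => by
    have hs := h.2 t (by omega)
    rw [hs.input]
    exact hs.solve.1.tubeFeasible.mem_Z hD

end MPCData

/-! ### Regularity and positivity of the cost -/

theorem sqrt_add_le_sqrt_add_sqrt {a b : ℝ} (ha : 0 ≤ a) (hb : 0 ≤ b) : √(a + b) ≤ √a + √b := by
  rw [Real.sqrt_le_left (by positivity), add_sq, Real.sq_sqrt ha, Real.sq_sqrt hb]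
  have : 0 ≤ √a * √b := by positivity
  linarith

theorem abs_wsq_sub_wsq_le {n : ℕ} {P : Matrix (Fin n) (Fin n) ℝ} {b : ℝ}
    (hP : ∀ x y, |x ⬝ᵥ (P *ᵥ y)| ≤ b * (‖x‖ * ‖y‖)) (x y : Fin n → ℝ) :
    |wsq P x - wsq P y| ≤ b * (‖x - y‖ * (‖x‖ + ‖y‖)) := by
  have e : wsq P x - wsq P y = (x - y) ⬝ᵥ (P *ᵥ x) + y ⬝ᵥ (P *ᵥ (x - y)) := by
    rw [wsq, wsq, sub_dotProduct, mulVec_sub, dotProduct_sub]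
    ring
  rw [e]
  calc _ ≤ b * (‖x - y‖ * ‖x‖) + b * (‖y‖ * ‖x - y‖) :=
        (abs_add_le _ _).trans (add_le_add (hP _ _) (hP _ _))
    _ = _ := by ring

namespace MPCData

variable {nx nu p nc nw r na m : ℕ} {D : MPCData nx nu p nc nw r na m}

theorem exists_Bth_lipschitz : ∃ C, 0 ≤ C ∧ ∀ θ θ' u,
    ‖D.Bth θ *ᵥ u - D.Bth θ' *ᵥ u‖ ≤ C * (‖θ - θ'‖ * ‖u‖) :=
  exists_affine_family_lipschitz D.B0 D.B

theorem exists_Ath_lipschitz : ∃ C, 0 ≤ C ∧ ∀ θ θ' x,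
    ‖D.Ath θ *ᵥ x - D.Ath θ' *ᵥ x‖ ≤ C * (‖θ - θ'‖ * ‖x‖) :=
  exists_affine_family_lipschitz D.A0 D.A

theorem traj_shift (θ : Fin p → ℝ) (x : Fin nx → ℝ) (v : ℕ → Fin nu → ℝ) (k : ℕ) :
    D.traj θ (D.traj θ x v 1) (fun k => v (k + 1)) k = D.traj θ x v (k + 1) := by
  induction k with
  | zero => rfl
  | succ k ih => rw [traj, ih, traj.eq_def D θ x v (k + 1 + 1)]

/-- Along nominal predictions the cost of the shifted perturbations drops by the stage cost. -/
theorem Assumptions.cost_shift (hD : D.Assumptions) {θ : Fin p → ℝ} (hθ : θ ∈ D.Theta D.mu0)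
    (x : Fin nx → ℝ) {v : ℕ → Fin nu → ℝ} (hv : v D.N = 0) :
    D.cost θ (D.traj θ x v 1) (fun k => v (k + 1)) + (wsq D.Q x + wsq D.R (D.K *ᵥ x + v 0)) =
      D.cost θ x v := by
  let l : ℕ → ℝ := fun k => wsq D.Q (D.traj θ x v k) + wsq D.R (D.K *ᵥ D.traj θ x v k + v k)
  have h1 : ∑ k ∈ Finset.range D.N, l (k + 1) + l 0 = ∑ k ∈ Finset.range D.N, l k + l D.N := by
    rw [← Finset.sum_range_succ', Finset.sum_range_succ]
  -- The Lyapunov equation splits one more stage cost off the terminal cost, and this pays for the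
  -- stage that the shift adds.
  have h2 : wsq (D.lyapP θ) (D.traj θ x v D.N) =
      l D.N + wsq (D.lyapP θ) (D.traj θ x v (D.N + 1)) := by
    rw [hD.wsq_lyapP hθ, traj]
    simp only [l, hv, mulVec_zero, add_zero]
  have h3 : l 0 = wsq D.Q x + wsq D.R (D.K *ᵥ x + v 0) := rfl
  have h4 : D.cost θ (D.traj θ x v 1) (fun k => v (k + 1)) =
      ∑ k ∈ Finset.range D.N, l (k + 1) + wsq (D.lyapP θ) (D.traj θ x v (D.N + 1)) := by
    simp only [cost, traj_shift, l]
  have h5 : D.cost θ x v =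
      ∑ k ∈ Finset.range D.N, l k + wsq (D.lyapP θ) (D.traj θ x v D.N) := rfl
  linarith

theorem traj_zero (θ : Fin p → ℝ) (x : Fin nx → ℝ) (k : ℕ) :
    D.traj θ x 0 k = (D.Phi θ ^ k) *ᵥ x := by
  induction k with
  | zero => simp [traj]
  | succ k ih => rw [traj, ih, Pi.zero_apply, mulVec_zero, add_zero, pow_succ', mulVec_mulVec]

theorem Assumptions.wsq_lyapP_eq_sum (hD : D.Assumptions) {θ : Fin p → ℝ}
    (hθ : θ ∈ D.Theta D.mu0) (x : Fin nx → ℝ) (k : ℕ) : wsq (D.lyapP θ) x =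
      (∑ i ∈ Finset.range k, (wsq D.Q (D.traj θ x 0 i) +
        wsq D.R (D.K *ᵥ D.traj θ x 0 i + (0 : ℕ → Fin nu → ℝ) i))) +
      wsq (D.lyapP θ) (D.traj θ x 0 k) := by
  induction k with
  | zero => simp [traj]
  | succ k ih =>
    rw [ih, Finset.sum_range_succ, hD.wsq_lyapP hθ (D.traj θ x 0 k), traj]
    simp only [Pi.zero_apply, mulVec_zero, add_zero]
    ring

theorem Assumptions.cost_zero (hD : D.Assumptions) {θ : Fin p → ℝ}
    (hθ : θ ∈ D.Theta D.mu0) (x : Fin nx → ℝ) : D.cost θ x 0 = wsq (D.lyapP θ) x :=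
  (hD.wsq_lyapP_eq_sum hθ x D.N).symm

theorem Assumptions.tendsto_Phi_pow (hD : D.Assumptions) {θ : Fin p → ℝ}
    (hθ : θ ∈ D.Theta D.mu0) (x : Fin nx → ℝ) :
    Filter.Tendsto (fun k => (D.Phi θ ^ k) *ᵥ x) Filter.atTop (nhds 0) := by
  obtain ⟨c, lam, -, h0, h1, h⟩ := hD.exists_Phi_pow_bound
  refine squeeze_zero_norm (h θ hθ · x) ?_
  simpa using ((tendsto_pow_atTop_nhds_zero_of_lt_one h0.le h1).const_mul c).mul_const ‖x‖

/-- By the Lyapunov equation the quadratic form at `x` is at least its value at `Φ(θ)^k x`, which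
tends to `0`. -/
theorem Assumptions.wsq_lyapP_nonneg (hD : D.Assumptions) {θ : Fin p → ℝ}
    (hθ : θ ∈ D.Theta D.mu0) (x : Fin nx → ℝ) : 0 ≤ wsq (D.lyapP θ) x := by
  have hlim : Filter.Tendsto (fun k => wsq (D.lyapP θ) (D.traj θ x 0 k)) Filter.atTop
      (nhds (wsq (D.lyapP θ) 0)) := by
    simp only [traj_zero]
    exact ((continuous_wsq (D.lyapP θ)).tendsto 0).comp (hD.tendsto_Phi_pow hθ x)
  have h0 : wsq (D.lyapP θ) 0 = 0 := by simp [wsq]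
  rw [h0] at hlim
  refine le_of_tendsto' hlim fun k => ?_
  rw [hD.wsq_lyapP_eq_sum hθ x k]
  exact le_add_of_nonneg_left (Finset.sum_nonneg fun i _ =>
    add_nonneg (hD.Q_pos.wsq_nonneg _) (hD.R_pos.wsq_nonneg _))

theorem Assumptions.wsq_le_cost (hD : D.Assumptions) {θ : Fin p → ℝ}
    (hθ : θ ∈ D.Theta D.mu0) (x : Fin nx → ℝ) (v : ℕ → Fin nu → ℝ) :
    wsq D.Q x ≤ D.cost θ x v := by
  have hnn : ∀ k, 0 ≤ wsq D.R (D.K *ᵥ D.traj θ x v k + v k) := fun k => hD.R_pos.wsq_nonneg _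
  refine le_trans ?_ (le_add_of_nonneg_right (hD.wsq_lyapP_nonneg hθ _))
  refine le_trans (le_add_of_nonneg_right (hnn 0)) ?_
  exact Finset.single_le_sum (f := fun k => wsq D.Q (D.traj θ x v k) +
    wsq D.R (D.K *ᵥ D.traj θ x v k + v k)) (fun k _ => add_nonneg (hD.Q_pos.wsq_nonneg _) (hnn k))
    (Finset.mem_range.2 hD.N_pos)

theorem Assumptions.exists_traj_bound (hD : D.Assumptions) {ρ : ℝ} (hρ : 0 ≤ ρ) (k : ℕ) :
    ∃ C, 0 ≤ C ∧ ∀ θ ∈ D.Theta D.mu0, ∀ x v, ‖x‖ ≤ ρ → (∀ i, ‖v i‖ ≤ ρ) →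
      ‖D.traj θ x v k‖ ≤ C := by
  obtain ⟨a, ha, hΦ⟩ := exists_family_bound (exists_Phi_lipschitz (D := D)) hD.Theta0_bounded
  obtain ⟨b, hb, hB⟩ := exists_family_bound (exists_Bth_lipschitz (D := D)) hD.Theta0_bounded
  induction k with
  | zero => exact ⟨ρ, hρ, fun θ _ x v hx _ => hx⟩
  | succ k ih =>
    obtain ⟨C, hC, h⟩ := ih
    refine ⟨a * C + b * ρ, by positivity, fun θ hθ x v hx hv => ?_⟩
    exact (norm_add_le _ _).trans (add_le_add
      ((hΦ θ hθ _).trans (mul_le_mul_of_nonneg_left (h θ hθ x v hx hv) ha))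
      ((hB θ hθ _).trans (mul_le_mul_of_nonneg_left (hv k) hb)))

theorem Assumptions.exists_traj_lipschitz (hD : D.Assumptions) {ρ : ℝ} (hρ : 0 ≤ ρ) (k : ℕ) :
    ∃ L, 0 ≤ L ∧ ∀ θ ∈ D.Theta D.mu0, ∀ θ' ∈ D.Theta D.mu0, ∀ x x' v δ, ‖x'‖ ≤ ρ →
      (∀ i, ‖v i‖ ≤ ρ) → ‖θ - θ'‖ ≤ δ → ‖x - x'‖ ≤ δ →
      ‖D.traj θ x v k - D.traj θ' x' v k‖ ≤ L * δ := by
  obtain ⟨a, ha, hΦ⟩ := exists_family_bound (exists_Phi_lipschitz (D := D)) hD.Theta0_bounded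
  obtain ⟨f, hf, hΦl⟩ := exists_Phi_lipschitz (D := D)
  obtain ⟨b, hb, hBl⟩ := exists_Bth_lipschitz (D := D)
  induction k with
  | zero => exact ⟨1, zero_le_one, fun θ _ θ' _ x x' v δ _ _ _ h => by simpa [traj] using h⟩
  | succ k ih =>
    obtain ⟨L, hL, h⟩ := ih
    obtain ⟨C, hC, hb'⟩ := hD.exists_traj_bound hρ k
    refine ⟨a * L + f * C + b * ρ, by positivity,
      fun θ hθ θ' hθ' x x' v δ hx' hv hδ hδx => ?_⟩
    have hδ0 : 0 ≤ δ := (norm_nonneg _).trans hδ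
    have e : D.traj θ x v (k + 1) - D.traj θ' x' v (k + 1) =
        D.Phi θ *ᵥ (D.traj θ x v k - D.traj θ' x' v k) +
        (D.Phi θ *ᵥ D.traj θ' x' v k - D.Phi θ' *ᵥ D.traj θ' x' v k) +
        (D.Bth θ *ᵥ v k - D.Bth θ' *ᵥ v k) := by
      simp only [traj, mulVec_sub]
      abel
    rw [e]
    have h1 := (hΦ θ hθ _).trans (mul_le_mul_of_nonneg_left
      (h θ hθ θ' hθ' x x' v δ hx' hv hδ hδx) ha)
    have h2 := (hΦl θ θ' (D.traj θ' x' v k)).trans (mul_le_mul_of_nonneg_left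
      (mul_le_mul hδ (hb' θ' hθ' x' v hx' hv) (norm_nonneg _) hδ0) hf)
    have h3 := (hBl θ θ' (v k)).trans (mul_le_mul_of_nonneg_left
      (mul_le_mul hδ (hv k) (norm_nonneg _) hδ0) hb)
    calc _ ≤ a * (L * δ) + f * (δ * C) + b * (δ * ρ) :=
          (norm_add_le _ _).trans (add_le_add ((norm_add_le _ _).trans (add_le_add h1 h2)) h3)
      _ = _ := by ring

/-- The cost is Lipschitz in the nominal parameter and the initial state, locally uniformly. -/
theorem Assumptions.exists_cost_lipschitz (hD : D.Assumptions) {ρ : ℝ} (hρ : 0 ≤ ρ) :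
    ∃ L, 0 ≤ L ∧ ∀ θ ∈ D.Theta D.mu0, ∀ θ' ∈ D.Theta D.mu0, ∀ x x' v δ, ‖x‖ ≤ ρ → ‖x'‖ ≤ ρ →
      (∀ i, ‖v i‖ ≤ ρ) → ‖θ - θ'‖ ≤ δ → ‖x - x'‖ ≤ δ →
      |D.cost θ x v - D.cost θ' x' v| ≤ L * δ := by
  choose C hC hCb using hD.exists_traj_bound hρ
  choose l hl hlb using hD.exists_traj_lipschitz hρ
  obtain ⟨q, hq, hQ⟩ := exists_bilin_bound D.Q
  obtain ⟨s, hs, hR⟩ := exists_bilin_bound D.R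
  obtain ⟨κ, hκ, hK⟩ := exists_mulVec_bound D.K
  obtain ⟨b, hb, hP⟩ := hD.exists_lyapP_bound
  obtain ⟨e, he, hPl⟩ := hD.exists_lyapP_lipschitz
  refine ⟨(∑ k ∈ Finset.range D.N, (q * (l k * (C k + C k)) +
      s * (κ * l k * ((κ * C k + ρ) + (κ * C k + ρ))))) +
      (b * (l D.N * (C D.N + C D.N)) + e * (C D.N * C D.N)), ?_,
    fun θ hθ θ' hθ' x x' v δ hx hx' hv hδ hδx => ?_⟩
  · have : 0 ≤ ∑ k ∈ Finset.range D.N, (q * (l k * (C k + C k)) +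
        s * (κ * l k * ((κ * C k + ρ) + (κ * C k + ρ)))) :=
      Finset.sum_nonneg fun k _ => by
        have := hC k
        have := hl k
        positivity
    have := hC D.N
    have := hl D.N
    positivity
  have hδ0 : 0 ≤ δ := (norm_nonneg _).trans hδ
  set X := D.traj θ x v
  set X' := D.traj θ' x' v
  have hX : ∀ k, ‖X k‖ ≤ C k := fun k => hCb k θ hθ x v hx hv
  have hX' : ∀ k, ‖X' k‖ ≤ C k := fun k => hCb k θ' hθ' x' v hx' hv
  have hXX : ∀ k, ‖X k - X' k‖ ≤ l k * δ := fun k => hlb k θ hθ θ' hθ' x x' v δ hx' hv hδ hδx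
  have hU : ∀ (Y : ℕ → Fin nx → ℝ), (∀ k, ‖Y k‖ ≤ C k) → ∀ k,
      ‖D.K *ᵥ Y k + v k‖ ≤ κ * C k + ρ := fun Y hY k =>
    (norm_add_le _ _).trans (add_le_add ((hK _).trans (mul_le_mul_of_nonneg_left (hY k) hκ)) (hv k))
  have hUU : ∀ k, ‖(D.K *ᵥ X k + v k) - (D.K *ᵥ X' k + v k)‖ ≤ κ * (l k * δ) := fun k => by
    rw [add_sub_add_right_eq_sub, ← mulVec_sub]
    exact (hK _).trans (mul_le_mul_of_nonneg_left (hXX k) hκ)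
  have hstage : ∀ k, |(wsq D.Q (X k) + wsq D.R (D.K *ᵥ X k + v k)) -
      (wsq D.Q (X' k) + wsq D.R (D.K *ᵥ X' k + v k))| ≤
      (q * (l k * (C k + C k)) + s * (κ * l k * ((κ * C k + ρ) + (κ * C k + ρ)))) * δ := by
    intro k
    have hlk := hl k
    have hCk := hC k
    rw [add_sub_add_comm]
    calc _ ≤ q * (‖X k - X' k‖ * (‖X k‖ + ‖X' k‖)) +
          s * (‖(D.K *ᵥ X k + v k) - (D.K *ᵥ X' k + v k)‖ *
            (‖D.K *ᵥ X k + v k‖ + ‖D.K *ᵥ X' k + v k‖)) :=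
          (abs_add_le _ _).trans
            (add_le_add (abs_wsq_sub_wsq_le hQ _ _) (abs_wsq_sub_wsq_le hR _ _))
      _ ≤ q * ((l k * δ) * (C k + C k)) +
          s * ((κ * (l k * δ)) * ((κ * C k + ρ) + (κ * C k + ρ))) := by
          have e1 := hXX k
          have e2 := hX k
          have e3 := hX' k
          have e4 := hUU k
          have e5 := hU X hX k
          have e6 := hU X' hX' k
          gcongr
      _ = _ := by ring
  have hterm : |wsq (D.lyapP θ) (X D.N) - wsq (D.lyapP θ') (X' D.N)| ≤
      (b * (l D.N * (C D.N + C D.N)) + e * (C D.N * C D.N)) * δ := by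
    -- The change of the terminal state is separated from the change of the Lyapunov matrix.
    have e1 : wsq (D.lyapP θ) (X D.N) - wsq (D.lyapP θ') (X' D.N) =
        (wsq (D.lyapP θ) (X D.N) - wsq (D.lyapP θ) (X' D.N)) +
        X' D.N ⬝ᵥ ((D.lyapP θ - D.lyapP θ') *ᵥ X' D.N) := by
      rw [sub_mulVec, dotProduct_sub]
      simp only [wsq]
      ring
    rw [e1]
    calc _ ≤ b * (‖X D.N - X' D.N‖ * (‖X D.N‖ + ‖X' D.N‖)) +
          e * ‖θ - θ'‖ * (‖X' D.N‖ * ‖X' D.N‖) :=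
          (abs_add_le _ _).trans (add_le_add (abs_wsq_sub_wsq_le (hP θ hθ) _ _)
            (hPl θ hθ θ' hθ' _ _))
      _ ≤ b * ((l D.N * δ) * (C D.N + C D.N)) + e * δ * (C D.N * C D.N) := by
          have e1 := hXX D.N
          have e2 := hX D.N
          have e3 := hX' D.N
          have e4 := hC D.N
          have e5 := hl D.N
          gcongr
      _ = _ := by ring
  have hfin : D.cost θ x v - D.cost θ' x' v =
      (∑ k ∈ Finset.range D.N, ((wsq D.Q (X k) + wsq D.R (D.K *ᵥ X k + v k)) -
      (wsq D.Q (X' k) + wsq D.R (D.K *ᵥ X' k + v k)))) +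
      (wsq (D.lyapP θ) (X D.N) - wsq (D.lyapP θ') (X' D.N)) := by
    rw [Finset.sum_sub_distrib]
    simp only [cost]
    ring
  rw [hfin, add_mul, Finset.sum_mul]
  exact (abs_add_le _ _).trans (add_le_add
    ((Finset.abs_sum_le_sum_abs _ _).trans (Finset.sum_le_sum fun k _ => hstage k)) hterm)

/-! ### Behaviour near the origin and bounds on the optimal cost -/

/-- A neighbourhood of the origin from which a constant tube with zero perturbations is feasible. -/
theorem Assumptions.exists_terminal_ball (hD : D.Assumptions) (hne : D.XP.Nonempty) :
    ∃ ε : ℝ, 0 < ε ∧ ∃ a : Fin na → ℝ, ∀ μ ≤ D.mu0, ∀ x, ‖x‖ ≤ ε →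
      D.TubeFeasible μ x 0 fun _ => a := by
  obtain ⟨x₀, d, hd⟩ := hne
  have hw0 : (0 : Fin nx → ℝ) ∈ D.W := by
    rw [W, mem_ofPred_eq, mulVec_zero]
    exact fun i => (hD.pw_pos i).le
  set a := d.α D.N
  have htf := hd.tubeFeasible
  have hterm : ∀ j, ∃ L, D.TubeStep D.mu0 j a 0 a L := fun j => ⟨_, hd.term_tube j⟩
  -- The terminal tube condition makes the terminal cross section robustly invariant, in particular
  -- for the initial nominal parameter.
  have hinv : ∀ w ∈ D.W, ∀ x ∈ D.X a, D.Phi D.thbar0 *ᵥ x + w ∈ D.X a := fun w hw x hx => by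
    have := hD.tube_succ hD.thbar0_mem hw hterm hx
    rwa [mulVec_zero, add_zero] at this
  have htube : ∀ k, D.traj D.thbar0 x₀ d.v k ∈ D.X (d.α k) := by
    intro k
    induction k with
    | zero => exact htf.initial
    | succ k ih =>
      have := hD.tube_succ hD.thbar0_mem hw0 (htf.tube k) ih
      rwa [add_zero] at this
  set xN := D.traj D.thbar0 x₀ d.v D.N
  have hpow : ∀ k, (D.Phi D.thbar0 ^ k) *ᵥ xN ∈ D.X a := by
    intro k
    induction k with
    | zero =>
      rw [pow_zero, one_mulVec]
      exact htube D.N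
    | succ k ih =>
      have := hinv 0 hw0 _ ih
      rwa [add_zero, mulVec_mulVec, ← pow_succ'] at this
  have hcl : IsClosed (D.X a) := isClosed_le (by fun_prop) continuous_const
  -- Undisturbed nominal trajectories stay in this closed set and converge to the origin.
  have h0 : (0 : Fin nx → ℝ) ∈ D.X a :=
    hcl.mem_of_tendsto (hD.tendsto_Phi_pow hD.thbar0_mem xN) (Filter.Eventually.of_forall hpow)
  -- Irredundancy supplies a point with positive `i`-th row of `T`. A small multiple of it is an
  -- admissible disturbance because `π_w > 0`, and invariance from the origin forces `a i` to be
  -- positive.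
  have ha : ∀ i, 0 < a i := by
    intro i
    obtain ⟨x, -, hx⟩ := hD.minimal i
    have hcont : Filter.Tendsto (fun c : ℝ => D.Pw *ᵥ (c • x)) (nhdsWithin 0 (Ioi 0)) (nhds 0) := by
      have : Continuous fun c : ℝ => D.Pw *ᵥ (c • x) := by fun_prop
      simpa using (this.tendsto 0).mono_left nhdsWithin_le_nhds
    have hev : ∀ᶠ c : ℝ in nhdsWithin 0 (Ioi 0), ∀ i, (D.Pw *ᵥ (c • x)) i < D.pw i :=
      Filter.eventually_all.2 fun i =>
        ((tendsto_pi_nhds.1 hcont) i).eventually_lt_const (hD.pw_pos i)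
    obtain ⟨c, hc, hc0⟩ := (hev.and self_mem_nhdsWithin).exists
    have hcx := hinv (c • x) (fun i => (hc i).le) 0 h0 i
    rw [mulVec_zero, zero_add, mulVec_smul, Pi.smul_apply, smul_eq_mul] at hcx
    exact (mul_pos hc0 (one_pos.trans hx)).trans_le hcx
  obtain ⟨b, hb, hT⟩ := exists_mulVec_bound D.T
  obtain ⟨ε, hε, hε0⟩ := ((Filter.eventually_all.2 fun i => Ioc_mem_nhdsGT
    (div_pos (ha i) (by positivity : 0 < b + 1))).and self_mem_nhdsWithin).exists
  refine ⟨ε, hε0, a, fun μ hμ x hx => ⟨fun _ _ => rfl, fun _ _ => rfl, fun i => ?_,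
    fun k j => ?_, fun k j => (hterm j).imp fun _ hL => hL.mono hμ⟩⟩
  · have h1 := (le_abs_self _).trans ((norm_le_pi_norm (D.T *ᵥ x) i).trans (hT x))
    have h2 := (le_div_iff₀ (by positivity)).1 (hε i).2
    have h3 : b * ‖x‖ ≤ b * ε := mul_le_mul_of_nonneg_left hx hb
    have h4 : (0 : ℝ) < ε := hε0
    linarith
  · rw [Pi.zero_apply, mulVec_zero, add_zero]
    exact hd.term_state_input j

theorem Assumptions.zero_mem_interior_XP (hD : D.Assumptions) (hne : D.XP.Nonempty) :
    (0 : Fin nx → ℝ) ∈ interior D.XP := by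
  obtain ⟨ε, hε, a, h⟩ := hD.exists_terminal_ball hne
  refine mem_interior.2 ⟨Metric.ball 0 ε, fun x hx => ?_, Metric.isOpen_ball,
    Metric.mem_ball_self hε⟩
  obtain ⟨d, hd, -⟩ := (h D.mu0 le_rfl x (mem_ball_zero_iff.1 hx).le).exists_feasible
    D.thbar0 (D.refx0 x) (D.refu0 x)
  exact ⟨d, hd⟩

theorem Assumptions.exists_cost_bound (hD : D.Assumptions) {ρ : ℝ} (hρ : 0 ≤ ρ) :
    ∃ C, 0 ≤ C ∧ ∀ θ ∈ D.Theta D.mu0, ∀ x v, ‖x‖ ≤ ρ → (∀ i, ‖v i‖ ≤ ρ) → D.cost θ x v ≤ C := by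
  choose C hC hCb using hD.exists_traj_bound hρ
  obtain ⟨q, hq, hQ⟩ := exists_bilin_bound D.Q
  obtain ⟨s, hs, hR⟩ := exists_bilin_bound D.R
  obtain ⟨κ, hκ, hK⟩ := exists_mulVec_bound D.K
  obtain ⟨b, hb, hP⟩ := hD.exists_lyapP_bound
  refine ⟨(∑ k ∈ Finset.range D.N, (q * (C k * C k) + s * ((κ * C k + ρ) * (κ * C k + ρ)))) +
      b * (C D.N * C D.N), ?_, fun θ hθ x v hx hv => ?_⟩
  · have := hC D.N
    have : 0 ≤ ∑ k ∈ Finset.range D.N,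
        (q * (C k * C k) + s * ((κ * C k + ρ) * (κ * C k + ρ))) :=
      Finset.sum_nonneg fun k _ => by
        have := hC k
        positivity
    positivity
  have hX : ∀ k, ‖D.traj θ x v k‖ ≤ C k := fun k => hCb k θ hθ x v hx hv
  have hU : ∀ k, ‖D.K *ᵥ D.traj θ x v k + v k‖ ≤ κ * C k + ρ := fun k =>
    (norm_add_le _ _).trans (add_le_add ((hK _).trans (mul_le_mul_of_nonneg_left (hX k) hκ)) (hv k))
  have hsq : ∀ {n : ℕ} {M : Matrix (Fin n) (Fin n) ℝ} {c d : ℝ} (_ : 0 ≤ c)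
      (_ : ∀ x y, |x ⬝ᵥ (M *ᵥ y)| ≤ c * (‖x‖ * ‖y‖)) {y : Fin n → ℝ} (_ : ‖y‖ ≤ d),
      wsq M y ≤ c * (d * d) := by
    intro n M c d hc hM y hy
    refine (le_abs_self _).trans ((hM y y).trans (mul_le_mul_of_nonneg_left ?_ hc))
    exact mul_le_mul hy hy (norm_nonneg _) ((norm_nonneg _).trans hy)
  exact add_le_add (Finset.sum_le_sum fun k _ => add_le_add (hsq hq hQ (hX k)) (hsq hs hR (hU k)))
    (hsq hb (hP θ hθ) (hX D.N))

/-- A common bound on states, inputs and perturbations of feasible problems. -/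
theorem Assumptions.exists_state_bound (hD : D.Assumptions) : ∃ ρ, 0 ≤ ρ ∧
    ∀ μ x v α, D.TubeFeasible μ x v α → ‖x‖ ≤ ρ ∧ ‖D.K *ᵥ x + v 0‖ ≤ ρ ∧ ∀ k, ‖v k‖ ≤ ρ := by
  obtain ⟨ρ₁, hρ₁, hρv⟩ := hD.exists_feasible_bound
  obtain ⟨ρ₂, hρ₂, hρZ⟩ := hD.Z_compact.isBounded.exists_pos_norm_le
  refine ⟨max ρ₁ ρ₂, le_max_of_le_left hρ₁, fun μ x v α h => ?_⟩
  have hZ := hρZ _ (h.mem_Z hD)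
  exact ⟨le_max_of_le_right ((norm_fst_le _).trans hZ),
    le_max_of_le_right ((norm_snd_le _).trans hZ),
    fun k => le_max_of_le_left (hρv _ _ _ _ h k).1⟩

/-- The optimal cost is bounded by a multiple of the squared state. -/
theorem Assumptions.exists_value_upper_bound (hD : D.Assumptions) (hne : D.XP.Nonempty) :
    ∃ C, 0 ≤ C ∧ ∀ μ ≤ D.mu0, ∀ θ ∈ D.Theta D.mu0, ∀ x v α, D.TubeFeasible μ x v α →
      (∀ v' α', D.TubeFeasible μ x v' α' → D.cost θ x v ≤ D.cost θ x v') →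
      D.cost θ x v ≤ C * ‖x‖ ^ 2 := by
  obtain ⟨ε, hε, a, hball⟩ := hD.exists_terminal_ball hne
  obtain ⟨ρ, hρ, hbd⟩ := hD.exists_state_bound
  obtain ⟨b, hb, hP⟩ := hD.exists_lyapP_bound
  obtain ⟨C, hC, hcost⟩ := hD.exists_cost_bound hρ
  -- Inside the ball zero perturbations cost at most `b ‖x‖²`; outside it the uniform bound `C` is
  -- at most `C ‖x‖² / ε²`.
  refine ⟨b + C / ε ^ 2, by positivity, fun μ hμ θ hθ x v α hv hmin => ?_⟩
  rw [add_mul]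
  rcases le_or_gt ‖x‖ ε with hx | hx
  · refine le_add_of_le_of_nonneg ?_ (by positivity)
    refine (hmin _ _ (hball μ hμ x hx)).trans ?_
    rw [hD.cost_zero hθ, sq]
    exact (le_abs_self _).trans (hP θ hθ x x)
  · refine le_add_of_nonneg_of_le (by positivity) ?_
    obtain ⟨h1, -, h2⟩ := hbd _ _ _ _ hv
    refine (hcost θ hθ x v h1 h2).trans ?_
    rw [div_mul_eq_mul_div, le_div_iff₀ (by positivity)]
    exact mul_le_mul_of_nonneg_left (pow_le_pow_left₀ hε.le hx.le 2) hC

/-- Along closed loop runs the optimal cost decreases up to the effect of the disturbance and of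
the nominal parameter error. -/
theorem Assumptions.exists_decrease (hD : D.Assumptions) (hgam : D.gam = 0) :
    ∃ L, 0 ≤ L ∧ ∀ θs ∈ D.Theta D.mu0, ∀ w : ℕ → (Fin nx → ℝ), (∀ t, w t ∈ D.W) →
      ∀ τ t, τ.x 0 ∈ D.XP → D.RunTo θs w τ (t + 1) → ∀ d,
        D.IsSolution (τ.x (t + 1)) (τ.mu (t + 1)) (τ.thbar (t + 1)) (τ.xhat (t + 1))
          (τ.uhat (t + 1)) d →
        D.cost (τ.thbar (t + 1)) (τ.x (t + 1)) d.v + wsq D.Q (τ.x t) ≤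
          D.cost (τ.thbar t) (τ.x t) (τ.dec t).v +
            L * (l2norm (w t) + l2norm (τ.thbar t - θs)) := by
  obtain ⟨ρ, hρ, hbd⟩ := hD.exists_state_bound
  obtain ⟨C₁, hC₁, htraj⟩ := hD.exists_traj_bound hρ 1
  -- The nominal successor need not be a feasible state, so its own bound `C₁` enters the radius.
  obtain ⟨L, hL, hlip⟩ := hD.exists_cost_lipschitz (ρ := max ρ C₁) (le_max_of_le_left hρ)
  obtain ⟨la, hla, hA⟩ := exists_Ath_lipschitz (D := D)
  obtain ⟨lb, hlb, hB⟩ := exists_Bth_lipschitz (D := D)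
  refine ⟨L * (la * ρ + lb * ρ + 1), by positivity, fun θs hθs w hw τ t h0 h d hd => ?_⟩
  obtain ⟨i1, i2, i3, -⟩ := RunTo.invariant (t := t) hD hθs hw h0
    ⟨h.1, fun s hs => h.2 s (by omega)⟩
  obtain ⟨j1, j2, j3, -⟩ := h.invariant hD hθs hw h0
  have hs := h.2 t (by omega)
  have htf := hs.solve.1.tubeFeasible
  obtain ⟨hx, hu, hv⟩ := hbd _ _ _ _ htf
  have hθ := Theta_mono i1 i3
  have hθ' := Theta_mono j1 j3
  have hshift := htf.shift hD hs.mu_le i2 (hw t)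
  rw [← hs.input, ← hs.plant] at hshift
  obtain ⟨hx', -, hv'⟩ := hbd _ _ _ _ hshift
  set x₁ := D.traj (τ.thbar t) (τ.x t) (τ.dec t).v 1
  set e := l2norm (τ.thbar t - θs)
  have he : 0 ≤ e := l2norm_nonneg _
  have hwn : 0 ≤ l2norm (w t) := l2norm_nonneg _
  -- The true parameter competes in the projection, so the nominal parameter moves no farther than
  -- its current error.
  have hth : ‖τ.thbar (t + 1) - τ.thbar t‖ ≤ e := by
    rw [norm_sub_rev]
    exact (norm_le_l2norm _).trans (hs.thbar_min θs j2)
  have hthe : ‖θs - τ.thbar t‖ ≤ e := by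
    rw [norm_sub_rev]
    exact norm_le_l2norm _
  have hx₁ : x₁ = D.Ath (τ.thbar t) *ᵥ τ.x t + D.Bth (τ.thbar t) *ᵥ τ.u t := by
    simp only [x₁, traj]
    rw [hs.input, Phi_mulVec, mulVec_add, add_assoc]
  have hxx : ‖τ.x (t + 1) - x₁‖ ≤ (la * ρ + lb * ρ) * e + l2norm (w t) := by
    have e1 : τ.x (t + 1) - x₁ = (D.Ath θs *ᵥ τ.x t - D.Ath (τ.thbar t) *ᵥ τ.x t) +
        (D.Bth θs *ᵥ τ.u t - D.Bth (τ.thbar t) *ᵥ τ.u t) + w t := by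
      rw [hx₁, hs.plant]
      abel
    rw [← hs.input] at hu
    have h1 := (hA θs (τ.thbar t) (τ.x t)).trans (mul_le_mul_of_nonneg_left
      (mul_le_mul hthe hx (norm_nonneg _) he) hla)
    have h2 := (hB θs (τ.thbar t) (τ.u t)).trans (mul_le_mul_of_nonneg_left
      (mul_le_mul hthe hu (norm_nonneg _) he) hlb)
    rw [e1]
    calc _ ≤ la * (e * ρ) + lb * (e * ρ) + l2norm (w t) :=
          (norm_add_le _ _).trans (add_le_add ((norm_add_le _ _).trans (add_le_add h1 h2))
            (norm_le_l2norm _))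
      _ = _ := by ring
  have hpos : 0 ≤ la * ρ + lb * ρ := by positivity
  have key := hlip _ hθ' _ hθ (τ.x (t + 1)) x₁ (fun k => (τ.dec t).v (k + 1))
    ((la * ρ + lb * ρ + 1) * (l2norm (w t) + e)) (hx'.trans (le_max_left _ _))
    ((htraj _ hθ _ _ hx hv).trans (le_max_right _ _))
    (fun k => (hv (k + 1)).trans (le_max_left _ _))
    (hth.trans (by nlinarith)) (hxx.trans (by nlinarith))
  have hopt := (isSolution_iff hgam hd.1).1 hd _ _ hshift
  have hcs := hD.cost_shift hθ (τ.x t) (htf.v_tail D.N le_rfl)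
  have hRn := hD.R_pos.wsq_nonneg (D.K *ᵥ τ.x t + (τ.dec t).v 0)
  have := (abs_le.1 key).2
  rw [mul_assoc]
  linarith

/-! ### Comparison functions, decay of the optimal cost and input-to-state stability -/

theorem isClassK_const_mul_sqrt {c : ℝ} (hc : 0 < c) : IsClassK fun s => c * √s := by
  refine ⟨by fun_prop, fun a ha b _ hab => ?_, by simp⟩
  exact mul_lt_mul_of_pos_left (Real.sqrt_lt_sqrt ha hab) hc

theorem isClassKL_const_mul_rpow {c q : ℝ} (hc : 0 < c) (hq0 : 0 < q) (hq1 : q < 1) :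
    IsClassKL fun s t => c * s * q ^ t := by
  refine ⟨?_, fun t _ => ⟨by fun_prop, fun a _ b _ hab => ?_, by simp⟩, fun s hs => ⟨?_, ?_⟩⟩
  · have := (Real.continuous_const_rpow hq0.ne').comp (continuous_snd (X := ℝ) (Y := ℝ))
    exact ((continuous_const.mul continuous_fst).mul this).continuousOn
  · exact mul_lt_mul_of_pos_right (mul_lt_mul_of_pos_left hab hc) (Real.rpow_pos_of_pos hq0 t)
  · intro a _ b _ hab
    exact mul_le_mul_of_nonneg_left (Real.rpow_le_rpow_of_exponent_ge hq0 hq1.le hab)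
      (mul_nonneg hc.le hs)
  · simpa using (tendsto_rpow_atTop_of_base_lt_one q (by linarith) hq1).const_mul (c * s)

/-- Exponential decay of the optimal cost up to the effect of the disturbances and of the nominal
parameter errors. -/
theorem Assumptions.exists_cost_decay (hD : D.Assumptions) (hgam : D.gam = 0)
    (hne : D.XP.Nonempty) : ∃ C q M : ℝ, 0 < C ∧ 0 < q ∧ q < 1 ∧ 0 < M ∧
      ∀ θs ∈ D.Theta D.mu0, ∀ w : ℕ → (Fin nx → ℝ), (∀ t, w t ∈ D.W) → ∀ τ t e,
        τ.x 0 ∈ D.XP → D.RunTo θs w τ t →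
        (∀ k < t, l2norm (w k) + l2norm (τ.thbar k - θs) ≤ e) → 0 ≤ e → ∀ d,
        D.IsSolution (τ.x t) (τ.mu t) (τ.thbar t) (τ.xhat t) (τ.uhat t) d →
        D.cost (τ.thbar t) (τ.x t) d.v ≤ q ^ t * (C * l2norm (τ.x 0) ^ 2) + M * e := by
  obtain ⟨c₁, hc₁, hlow⟩ := hD.Q_pos.exists_wsq_lower_bound
  obtain ⟨C, hC, hup⟩ := hD.exists_value_upper_bound hne
  obtain ⟨L, hL, hdec⟩ := hD.exists_decrease hgam
  have hC' : 0 < C + 2 * c₁ := by positivity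
  have hup' : ∀ θs ∈ D.Theta D.mu0, ∀ w : ℕ → (Fin nx → ℝ), (∀ t, w t ∈ D.W) → ∀ τ t,
      τ.x 0 ∈ D.XP → D.RunTo θs w τ t → ∀ d,
      D.IsSolution (τ.x t) (τ.mu t) (τ.thbar t) (τ.xhat t) (τ.uhat t) d →
      D.cost (τ.thbar t) (τ.x t) d.v ≤ (C + 2 * c₁) * l2norm (τ.x t) ^ 2 := by
    intro θs hθs w hw τ t h0 h d hd
    obtain ⟨i1, -, i3, -⟩ := h.invariant hD hθs hw h0
    refine (hup _ i1 _ (Theta_mono i1 i3) _ _ _ hd.1.tubeFeasible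
      ((isSolution_iff hgam hd.1).1 hd)).trans ?_
    exact mul_le_mul (by linarith)
      (pow_le_pow_left₀ (norm_nonneg _) (norm_le_l2norm _) 2) (by positivity) hC'.le
  have hr0 : 0 < c₁ / (C + 2 * c₁) := by positivity
  have hr1 : c₁ / (C + 2 * c₁) < 1 := by
    rw [div_lt_one hC']
    linarith
  -- Enlarging `C` by `2 * c₁` puts the decay rate `r = c₁ / (C + 2 * c₁)` strictly between `0` and
  -- `1`. The error gain `M = (L + 1) / r` is the fixed point of `M = (1 - r) M + (L + 1)`, so the
  -- induction reproduces it.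
  refine ⟨C + 2 * c₁, 1 - c₁ / (C + 2 * c₁), (L + 1) / (c₁ / (C + 2 * c₁)), hC', by linarith,
    by linarith, by positivity, fun θs hθs w hw τ t e h0 => ?_⟩
  set q := 1 - c₁ / (C + 2 * c₁) with hq
  induction t with
  | zero =>
    intro h _ he d hd
    rw [pow_zero, one_mul]
    exact le_add_of_le_of_nonneg (hup' θs hθs w hw τ 0 h0 h d hd) (by positivity)
  | succ t ih =>
    intro h hk he d hd
    have ht : D.RunTo θs w τ t := ⟨h.1, fun s hs => h.2 s (by omega)⟩
    have hsol := (h.2 t (by omega)).solve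
    have h1 := ih ht (fun k hk' => hk k (by omega)) he _ hsol
    have h2 := hup' θs hθs w hw τ t h0 ht _ hsol
    have h3 := hdec θs hθs w hw τ t h0 h d hd
    have h4 := hlow (τ.x t)
    have h5 : L * (l2norm (w t) + l2norm (τ.thbar t - θs)) ≤ (L + 1) * e :=
      mul_le_mul (by linarith) (hk t (by omega))
        (add_nonneg (l2norm_nonneg _) (l2norm_nonneg _)) (by linarith)
    set V := D.cost (τ.thbar t) (τ.x t) (τ.dec t).v
    have h6 : c₁ / (C + 2 * c₁) * V ≤ c₁ * l2norm (τ.x t) ^ 2 := by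
      rw [div_mul_eq_mul_div, div_le_iff₀ hC']
      nlinarith
    have h7 : q * V ≤ q * (q ^ t * ((C + 2 * c₁) * l2norm (τ.x 0) ^ 2) +
        (L + 1) / (c₁ / (C + 2 * c₁)) * e) :=
      mul_le_mul_of_nonneg_left h1 (by linarith)
    have h8 : q * ((L + 1) / (c₁ / (C + 2 * c₁)) * e) + (L + 1) * e =
        (L + 1) / (c₁ / (C + 2 * c₁)) * e := by
      rw [hq]
      field_simp
      ring
    have h9 : q * V = V - c₁ / (C + 2 * c₁) * V := by rw [hq]; ring
    rw [pow_succ']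
    linarith

theorem Assumptions.isISS (hD : D.Assumptions) (hgam : D.gam = 0) (hne : D.XP.Nonempty) :
    D.IsISS D.XP := by
  obtain ⟨c₁, hc₁, hlow⟩ := hD.Q_pos.exists_wsq_lower_bound
  obtain ⟨C, q, M, hC, hq0, hq1, hM, hdecay⟩ := hD.exists_cost_decay hgam hne
  -- The cost decays like `q ^ t` and is quadratic in the state, so the norm decays like `√q ^ t`
  -- and the gains are square roots.
  refine ⟨hD.zero_mem_interior_XP hne, fun s t => √(C / c₁) * s * √q ^ t,
    fun s => √(M / c₁) * √s, fun s => √(M / c₁) * √s,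
    isClassKL_const_mul_rpow (by positivity) (by positivity)
      (by rw [Real.sqrt_lt' one_pos]; simpa using hq1),
    isClassK_const_mul_sqrt (by positivity), isClassK_const_mul_sqrt (by positivity),
    fun θs hθs w hw τ t h0 h => ?_⟩
  set a := ⨆ k : Fin t, l2norm (w k)
  set b := ⨆ k : Fin t, l2norm (τ.thbar k - θs)
  have ha : 0 ≤ a := Real.iSup_nonneg fun _ => l2norm_nonneg _
  have hb : 0 ≤ b := Real.iSup_nonneg fun _ => l2norm_nonneg _
  have hk : ∀ k < t, l2norm (w k) + l2norm (τ.thbar k - θs) ≤ a + b := fun k hk =>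
    add_le_add (le_ciSup (f := fun k : Fin t => l2norm (w k)) (finite_range _).bddAbove ⟨k, hk⟩)
      (le_ciSup (f := fun k : Fin t => l2norm (τ.thbar k - θs)) (finite_range _).bddAbove ⟨k, hk⟩)
  obtain ⟨d, hd⟩ := (hD.wellPosed hgam θs hθs w hw).2 τ t h0 h
  obtain ⟨i1, -, i3, -⟩ := h.invariant hD hθs hw h0
  have h1 := hdecay θs hθs w hw τ t (a + b) h0 h hk (by positivity) d hd
  have h2 := (hlow _).trans ((hD.wsq_le_cost (Theta_mono i1 i3) (τ.x t) d.v).trans h1)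
  have h3 : l2norm (τ.x t) ^ 2 ≤
      C / c₁ * l2norm (τ.x 0) ^ 2 * q ^ t + (M / c₁ * a + M / c₁ * b) := by
    rw [mul_comm, ← le_div_iff₀ hc₁] at h2
    refine h2.trans (le_of_eq ?_)
    field_simp
  have h4 := Real.le_sqrt_of_sq_le h3
  refine h4.trans ((sqrt_add_le_sqrt_add_sqrt (by positivity) (by positivity)).trans ?_)
  rw [add_assoc]
  refine add_le_add (le_of_eq ?_) ?_
  · beta_reduce
    rw [Real.sqrt_mul (by positivity), Real.sqrt_mul (by positivity),
      Real.sqrt_sq (l2norm_nonneg _), Real.rpow_natCast]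
    congr 1
    rw [Real.sqrt_eq_iff_mul_self_eq (by positivity) (by positivity), ← sq, pow_right_comm,
      Real.sq_sqrt hq0.le]
  · refine (sqrt_add_le_sqrt_add_sqrt (by positivity) (by positivity)).trans (le_of_eq ?_)
    rw [Real.sqrt_mul (by positivity), Real.sqrt_mul (by positivity)]

end MPCData

theorem mainTheorem4 {nx nu p nc nw r na m : ℕ} (D : MPCData nx nu p nc nw r na m)
    (hD : D.Assumptions) (hgam : D.gam = 0) (hne : D.XP.Nonempty) :
    D.WellPosed D.XP ∧ D.RobustConstraints D.XP ∧ D.IsISS D.XP :=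
  ⟨hD.wellPosed hgam, hD.robustConstraints, hD.isISS hgam hne⟩
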